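/- Let $p$ be a prime and let $R_1,R_2$ be complete discrete valuation rings of characteristic $0$ with perfect residue fields $k_1,k_2$ of characteristic $p$. For $i=1,2$ let $\mathfrak m_i$ be the maximal ideal of $R_i$, $\nu_i$ its normalized discrete valuation, $R_{i,n}=R_i/\mathfrak m_i^n$, $L_i=\operatorname{Frac}(R_i)$, and let $K_i\subseteq L_i$ be the fraction field of the canonical subring $W(k_i)\subseteq R_i$ (Witt vectors). Let $\widetilde{\nu_i}$ be the unique valuation on an algebraic closure $L_i^{alg}$ that extends a multiple of $\nu_i$ and satisfies $\widetilde{\nu_i}(p)=1$. For a uniformizer $\pi_1$ of $R_1$ put $$M(R_1)=\max\{\widetilde{\nu_1}(\pi_1-\sigma(\pi_1)) : \sigma\in\operatorname{Hom}_{K_1}(L_1,L_1^{alg}),\ \sigma(\pi_1)\ne\pi_1\},$$ with $\max\emptyset=-\infty$. Let $n_1,n_2\ge 1$. A ring homomorphism $g:R_1\to R_2$ is called an $(n_1,n_2)$-lifting of a ring homomorphism $\phi:R_{1,n_1}\to R_{2,n_2}$ at a uniformizer $\varpi$ of $R_1$ if (i) there is a representative $\beta\in R_2$ of $\phi(\varpi+\mathfrak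 m_1^{n_1})$ such that $\widetilde{\nu_2}(g(\varpi)-\beta)>\widetilde{\nu_2}(\sigma(g(\varpi))-\beta)$ for every $\sigma\in\operatorname{Hom}_{K_2}(L_2,L_2^{alg})$ with $\sigma(g(\varpi))\neq g(\varpi)$; and (ii) $g$ and $\phi$ induce the same map $k_1\to k_2$. Fix a uniformizer $\pi_1$ of $R_1$ and suppose $n_2>M(R_1)\,\nu_1(p)\,\nu_2(p)$, with $M(R_1)$ computed from $\pi_1$. Then every ring homomorphism $\phi:R_{1,n_1}\to R_{2,n_2}$ has a unique $(n_1,n_2)$-lifting $\operatorname{L}(\phi):R_1\to R_2$; the lifting does not depend on the uniformizer, i.e. for every uniformizer $\varpi$ of $R_1$ the homomorphism $\operatorname{L}(\phi)$ is the one and only $(n_1,n_2)$-lifting of $\phi$ at $\varpi$. Moreover, if $\phi$ is an isomorphism, and $n_2\ge2$ or $\nu_1(p)=\nu_2(p)$, then $\operatorname{L}(\phi)$ is an isomorphism. -/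

import Mathlib

open IsLocalRing

noncomputable section

namespace DVRLift

/-! ### The Witt subring of a complete discrete valuation ring -/

section Witt

variable (p : ℕ) (R : Type*) [CommRing R] [IsLocalRing R] [CharP (ResidueField R) p]

theorem natCast_mem_maximalIdeal : (p : R) ∈ maximalIdeal R := by
  rw [← IsLocalRing.residue_eq_zero_iff, map_natCast, CharP.cast_eq_zero]

variable [Fact p.Prime]

theorem ker_map_residue_le (n : ℕ) :
    RingHom.ker (WittVector.map (p := p) (residue R)) ≤
      RingHom.ker ((Ideal.Quotient.mk (maximalIdeal R ^ (n + 1))).comp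
        (WittVector.ghostComponent (p := p) n)) := by
  intro x hx
  simp only [RingHom.mem_ker, WittVector.map_eq_zero_iff, IsLocalRing.residue_eq_zero_iff] at hx
  simp only [RingHom.mem_ker, RingHom.comp_apply, Ideal.Quotient.eq_zero_iff_mem]
  rw [WittVector.ghostComponent_apply, wittPolynomial, map_sum]
  refine Ideal.sum_mem _ fun i hi => ?_
  have hin : i ≤ n := Nat.le_of_lt_succ (Finset.mem_range.mp hi)
  have h1 : (MvPolynomial.aeval x.coeff) ((MvPolynomial.monomial (R := ℤ)
      (Finsupp.single i (p ^ (n - i)))) (p ^ i)) = ((p : R) ^ i) * (x.coeff i) ^ (p ^ (n - i)) := by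
    simp [MvPolynomial.aeval_monomial, map_pow]
  rw [h1]
  have h2 : n + 1 ≤ i + p ^ (n - i) := by
    have := Nat.lt_pow_self (n := n - i) (Fact.out (p := p.Prime)).one_lt
    omega
  refine Ideal.pow_le_pow_right h2 ?_
  rw [pow_add]
  exact Ideal.mul_mem_mul (Ideal.pow_mem_pow (natCast_mem_maximalIdeal p R) _)
    (Ideal.pow_mem_pow (hx i) _)

/-- The map `W(k) → R / 𝔪 ^ (n + 1)` sending the Witt vector of residues of `(a₀, a₁, …)` to the
class of the ghost component `∑ i ≤ n, p ^ i * a_i ^ (p ^ (n - i))`. -/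
def ghostMod (n : ℕ) : WittVector p (ResidueField R) →+* R ⧸ maximalIdeal R ^ (n + 1) :=
  RingHom.liftOfSurjective (WittVector.map (residue R))
    (WittVector.map_surjective _ IsLocalRing.residue_surjective)
    ⟨(Ideal.Quotient.mk (maximalIdeal R ^ (n + 1))).comp (WittVector.ghostComponent n),
      ker_map_residue_le p R n⟩

theorem ghostMod_map (n : ℕ) (x : WittVector p R) :
    ghostMod p R n (WittVector.map (residue R) x) =
      Ideal.Quotient.mk _ (WittVector.ghostComponent n x) :=
  RingHom.liftOfSurjective_comp_apply ..

variable [PerfectField (ResidueField R)]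

/-- `ghostMod` precomposed with the inverse of the `n`-th iterate of the Frobenius of `W(k)`. -/
def wittMod (n : ℕ) : WittVector p (ResidueField R) →+* R ⧸ maximalIdeal R ^ (n + 1) :=
  (ghostMod p R n).comp (WittVector.map
    (((frobeniusEquiv (ResidueField R) p).symm ^ n : ResidueField R ≃+* ResidueField R) :
      ResidueField R →+* ResidueField R))

theorem wittMod_teichmuller (n : ℕ) (x : ResidueField R) (a : R)
    (ha : residue R a ^ p ^ n = x) :
    wittMod p R n (WittVector.teichmuller p x) = Ideal.Quotient.mk _ (a ^ p ^ n) := by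
  have h : ((frobeniusEquiv (ResidueField R) p).symm ^ n :
      ResidueField R ≃+* ResidueField R) x = residue R a := by
    rw [← ha]
    clear ha
    induction n with
    | zero => simp
    | succ n ih =>
      rw [pow_succ, RingAut.mul_apply, pow_succ p n, pow_mul, ← frobeniusEquiv_def,
        RingEquiv.symm_apply_apply, ih]
  rw [wittMod, RingHom.comp_apply, WittVector.map_teichmuller]
  erw [h]
  rw [← WittVector.map_teichmuller, ghostMod_map, WittVector.ghostComponent_teichmuller]

theorem factorPowSucc_comp_wittMod (n : ℕ) :
    (Ideal.Quotient.factorPowSucc (maximalIdeal R) (n + 1)).comp (wittMod p R (n + 1)) =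
      wittMod p R n := by
  apply WittVector.eq_of_apply_teichmuller_eq
  · refine ⟨n + 1, ?_⟩
    rw [← map_natCast (Ideal.Quotient.mk (maximalIdeal R ^ (n + 1))), ← map_pow,
      Ideal.Quotient.eq_zero_iff_mem]
    exact Ideal.pow_mem_pow (natCast_mem_maximalIdeal p R) _
  · intro x
    obtain ⟨y, hy⟩ := (iterateFrobeniusEquiv (ResidueField R) p (n + 1)).surjective x
    obtain ⟨a, rfl⟩ := IsLocalRing.residue_surjective y
    rw [iterateFrobeniusEquiv_def] at hy
    have hy' : residue R (a ^ p) ^ p ^ n = x := by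
      rw [map_pow, ← pow_mul, ← pow_succ', hy]
    rw [RingHom.comp_apply, wittMod_teichmuller p R (n + 1) x a hy,
      wittMod_teichmuller p R n x (a ^ p) hy', ← pow_mul, ← pow_succ']
    rfl

/-- For a complete local ring `R` with perfect residue field `k` of characteristic `p`, the
canonical homomorphism `W(k) → R` that induces the identity on `k`. -/
def wittEmbedding [IsAdicComplete (maximalIdeal R) R] : WittVector p (ResidueField R) →+* R :=
  IsAdicComplete.StrictMono.liftRingHom (maximalIdeal R) Order.succ_strictMono _
    (factorPowSucc_comp_wittMod p R _)

theorem residue_wittEmbedding [IsAdicComplete (maximalIdeal R) R]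
    (w : WittVector p (ResidueField R)) : residue R (wittEmbedding p R w) = w.coeff 0 := by
  obtain ⟨v, rfl⟩ := WittVector.map_surjective (p := p) (residue R)
    IsLocalRing.residue_surjective w
  have h : Ideal.Quotient.mk (maximalIdeal R ^ (0 + 1))
      (wittEmbedding p R (WittVector.map (residue R) v)) =
      wittMod p R 0 (WittVector.map (residue R) v) :=
    IsAdicComplete.StrictMono.mk_liftRingHom (maximalIdeal R) Order.succ_strictMono _
      (factorPowSucc_comp_wittMod p R _) _
  have h0 : wittMod p R 0 (WittVector.map (residue R) v) =
      ghostMod p R 0 (WittVector.map (residue R) v) := by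
    rw [wittMod, RingHom.comp_apply]
    congr 1
  rw [h0, ghostMod_map, Ideal.Quotient.eq, zero_add, pow_one] at h
  have h1 := (IsLocalRing.residue_eq_zero_iff _).mpr h
  rw [map_sub, sub_eq_zero] at h1
  rw [h1, WittVector.map_coeff]
  simp [WittVector.ghostComponent_apply]

end Witt

/-! ### Valuations on a complete discrete valuation ring of characteristic zero -/

section Valuation

variable (p : ℕ) (R : Type*) [CommRing R] [IsDomain R] [IsDiscreteValuationRing R]

/-- The discrete valuation `ν` of the fraction field, normalized by `ν(π) = 1`, at a nonzero
element; the value at `0` is a dummy that is never used. -/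
def ord (x : FractionRing R) : ℤ :=
  -WithZero.log ((IsDiscreteValuationRing.maximalIdeal R).valuation (FractionRing R) x)

/-- `ν(p)`, the absolute ramification index. -/
def ramIndex : ℤ := ord R (p : FractionRing R)

/-- The valuation `ν̃` on the algebraic closure of `L = Frac R`, normalized by `ν̃(p) = 1`. As `R`
is complete, the valuation of `L` extends uniquely, by the norm formula: if `y ≠ 0` has minimal
polynomial `X ^ d + ⋯ + a₀` over `L`, then `ν̃(y) = ν(a₀) / (d * ν(p))`; and `ν̃(0) = ∞`. -/
def normVal (y : AlgebraicClosure (FractionRing R)) : EReal :=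
  open Classical in
  if y = 0 then ⊤
  else (((ord R ((minpoly (FractionRing R) y).coeff 0) : ℝ) /
    ((minpoly (FractionRing R) y).natDegree * ramIndex p R) : ℝ) : EReal)

variable [Fact p.Prime] [CharP (ResidueField R) p] [PerfectField (ResidueField R)]
  [IsAdicComplete (maximalIdeal R) R]

/-- `K`, the fraction field of `W(k) ⊆ R` inside `L = Frac R`. -/
def wittField : Subfield (FractionRing R) :=
  Subfield.closure (Set.range fun w => algebraMap R (FractionRing R) (wittEmbedding p R w))

/-- `Hom_K(L, L^alg)`. -/
abbrev Embeddings : Type _ :=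
  FractionRing R →ₐ[wittField p R] AlgebraicClosure (FractionRing R)

variable {R}

/-- An element of `R`, viewed in `L^alg`. -/
def toAlg (x : R) : AlgebraicClosure (FractionRing R) :=
  algebraMap (FractionRing R) _ (algebraMap R (FractionRing R) x)

/-- The conjugate `σ(x) ∈ L^alg` of `x ∈ R`. -/
def conj (σ : Embeddings p R) (x : R) : AlgebraicClosure (FractionRing R) :=
  σ (algebraMap R (FractionRing R) x)

/-- `M(R)`, computed with the uniformizer `π`: the largest `ν̃(π - σ(π))` over the finitely many
`σ ∈ Hom_K(L, L^alg)` with `σ(π) ≠ π`. If there is no such `σ` (the case `L = K`), it is `-∞`. -/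
def M (π : R) : EReal :=
  ⨆ σ : {σ : Embeddings p R // conj p σ π ≠ toAlg π}, normVal p R (toAlg π - conj p σ.1 π)

end Valuation

/-! ### Liftings -/

section Lifting

variable {R₁ R₂ : Type*} [CommRing R₁] [CommRing R₂]

/-- The `n`-th residue ring `R / 𝔪 ^ n` of a local ring. -/
abbrev ResidueRing (R : Type*) [CommRing R] [IsLocalRing R] (n : ℕ) : Type _ :=
  R ⧸ maximalIdeal R ^ n

/-- The projection `R → R / 𝔪 ^ n`. -/
abbrev pr (R : Type*) [CommRing R] [IsLocalRing R] (n : ℕ) : R →+* ResidueRing R n :=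
  Ideal.Quotient.mk (maximalIdeal R ^ n)

/-- The projection `R / 𝔪 ^ n → k` for `n ≥ 1`. -/
def prResidue (R : Type*) [CommRing R] [IsLocalRing R] {n : ℕ} (hn : 0 < n) :
    ResidueRing R n →+* ResidueField R :=
  Ideal.Quotient.factor (Ideal.pow_le_self hn.ne')

/-- The homomorphism `k₁ → k₂` induced by `φ : R₁ / 𝔪₁ ^ n₁ → R₂ / 𝔪₂ ^ n₂`. -/
def redHom [IsLocalRing R₁] [IsLocalRing R₂] {n₁ n₂ : ℕ} (hn₂ : 0 < n₂)
    (φ : ResidueRing R₁ n₁ →+* ResidueRing R₂ n₂) : ResidueField R₁ →+* ResidueField R₂ :=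
  Ideal.Quotient.lift (maximalIdeal R₁) ((prResidue R₂ hn₂).comp (φ.comp (pr R₁ n₁)))
    fun a ha => by
      have h : pr R₁ n₁ a ^ n₁ = 0 := by
        rw [← map_pow]
        exact Ideal.Quotient.eq_zero_iff_mem.mpr (Ideal.pow_mem_pow ha _)
      have h2 : prResidue R₂ hn₂ (φ (pr R₁ n₁ a)) ^ n₁ = 0 := by
        rw [← map_pow, ← map_pow, h, map_zero, map_zero]
      exact eq_zero_of_pow_eq_zero h2

variable (p : ℕ) [Fact p.Prime]
  [IsDomain R₁] [IsDiscreteValuationRing R₁]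
  [IsDomain R₂] [IsDiscreteValuationRing R₂]
  [CharP (ResidueField R₂) p] [PerfectField (ResidueField R₂)]
  [IsAdicComplete (maximalIdeal R₂) R₂]

/-- `g : R₁ → R₂` is an `(n₁, n₂)`-lifting of `φ : R₁ / 𝔪₁ ^ n₁ → R₂ / 𝔪₂ ^ n₂` at the
uniformizer `π` of `R₁`. -/
structure IsLiftingAt (π : R₁) {n₁ n₂ : ℕ} (hn₂ : 0 < n₂)
    (φ : ResidueRing R₁ n₁ →+* ResidueRing R₂ n₂) (g : R₁ →+* R₂) : Prop where
  /-- Some representative `β` of `φ(π)` is closer to `g(π)` than to every other conjugate of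
  `g(π)` over `K₂`. -/
  close : ∃ β : R₂, pr R₂ n₂ β = φ (pr R₁ n₁ π) ∧
    ∀ σ : Embeddings p R₂, conj p σ (g π) ≠ toAlg (g π) →
      normVal p R₂ (conj p σ (g π) - toAlg β) < normVal p R₂ (toAlg (g π) - toAlg β)
  /-- `g` and `φ` induce the same map on residue fields. -/
  residue_eq : ∀ x : R₁, redHom hn₂ φ (residue R₁ x) = residue R₂ (g x)

end Lifting

end DVRLift

end

/-! Let `e₁`, `e₂` be the ramification indices and write `|·|` for `exp (-ν̃)`. Over `W(k₁)` a
uniformizer `ϖ` of `R₁` generates `R₁` and is a root of an Eisenstein polynomial `E` of degree `e₁`,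
so `R₁ = W(k₁)[X] / (E)`. A homomorphism out of `W(k₁)` into `R₂` or `R₂ / 𝔪₂ ^ n` is determined by
its effect on residue fields, since `k₁` is perfect. Hence the `g : R₁ → R₂` inducing the same
residue map as `φ` correspond to the roots in `R₂` of `E'`, the image of `E` under `W(k₁) → W(k₂) →
R₂`.

If `β` represents `φ(ϖ)`, then `E'(β) ∈ 𝔪₂ ^ n₂`, so the root of `E'` nearest to `β` satisfies `|α -
β| ^ e₁ ≤ exp (-n₂ / e₂)`. The roots of `E'` have the same mutual distances as those of `E`
(`IsNormVal.exists_conj_sub_eq`), and the hypothesis on `M` says that the `e₁`-th powers of these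
distances exceed `exp (-n₂ / e₂)` (`separated_of_M_lt`). By Krasner's argument the nearest root lies
in `R₂` (`IsNormVal.exists_root`), and no other root is within the bound. This yields exactly one
`g` (`existsUnique_isCloseLift`).

The bound `|y| ^ e₁ ≤ exp (-n₂ / e₂)` cuts out an ideal, so closeness of `g` to `φ` can be required
at all elements of `R₁` at once, without choosing a uniformizer (`IsCloseLift.of_uniformizer`). As
`E'` is again Eisenstein over `W(k₂)`, its roots are the `K₂`-conjugates of `g(ϖ)`, and closeness is
equivalent to the lifting condition at any `ϖ` (`isLiftingAt_iff_isCloseLift`).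

For an isomorphism `φ` it remains to see `e₁ = e₂`. When `e₁ ≥ 2` the hypothesis on `M` forces `e₂ <
n₂`, so `e₂` can be read off in `R₂ / 𝔪₂ ^ n₂` (`ramIdx_eq_of_surjective`). -/

noncomputable section

namespace DVRLift

/-! ### The extension of the valuation to the algebraic closure -/

section Norm

open IsDedekindDomain Polynomial
open scoped NNReal

variable (p : ℕ) (R : Type*) [CommRing R] [IsDomain R] [IsDiscreteValuationRing R]

theorem mem_maximalIdeal_pow_iff_le_ord {x : R} (hx : x ≠ 0) (n : ℕ) :
    x ∈ maximalIdeal R ^ n ↔ (n : ℤ) ≤ ord R (algebraMap R (FractionRing R) x) := by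
  have h := (IsDiscreteValuationRing.maximalIdeal R).intValuation_le_pow_iff_mem x n
  rw [show (IsDiscreteValuationRing.maximalIdeal R).asIdeal = maximalIdeal R from rfl] at h
  rw [← h, ord, HeightOneSpectrum.valuation_of_algebraMap, ← WithZero.log_le_iff_le_exp
    (HeightOneSpectrum.intValuation_ne_zero _ x hx)]
  omega

theorem ord_nonneg_iff {x : FractionRing R} (hx : x ≠ 0) :
    0 ≤ ord R x ↔ x ∈ (algebraMap R (FractionRing R)).range := by
  constructor
  · intro h
    apply HeightOneSpectrum.mem_integers_of_valuation_le_one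
    intro v
    have hv : v = IsDiscreteValuationRing.maximalIdeal R :=
      HeightOneSpectrum.ext (IsLocalRing.eq_maximalIdeal v.isMaximal)
    rw [hv, ← WithZero.exp_zero, ← WithZero.log_le_iff_le_exp
      ((Valuation.ne_zero_iff _).mpr hx)]
    rw [ord] at h
    omega
  · rintro ⟨y, rfl⟩
    have hy : y ≠ 0 := by rintro rfl; simp at hx
    simpa using (mem_maximalIdeal_pow_iff_le_ord R hy 0).mp (by simp)

variable {R} in
theorem ramIndex_pos [CharZero R] [Fact p.Prime] [CharP (ResidueField R) p] :
    0 < ramIndex p R := by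
  have h := (mem_maximalIdeal_pow_iff_le_ord R (x := (p : R))
    (by exact_mod_cast (Fact.out : p.Prime).ne_zero) 1).mp
    (by simpa using natCast_mem_maximalIdeal p R)
  rw [map_natCast] at h
  rw [ramIndex]
  omega

theorem exists_absoluteValue (e : ℝ) (he : 0 < e) :
    ∃ a : AbsoluteValue (FractionRing R) ℝ, IsNonarchimedean a ∧
      ∀ x, x ≠ 0 → a x = Real.exp (-(ord R x : ℝ) / e) := by
  -- With this base and `e = ν(p)`, the norm of `p` is `exp (-1)`, in accordance with `ν̃(p) = 1`.
  have hb : 1 < (Real.exp (1 / e)).toNNReal := by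
    rw [Real.one_lt_toNNReal]
    simpa using he
  refine ⟨(IsDiscreteValuationRing.maximalIdeal R).adicAbv hb,
    HeightOneSpectrum.isNonarchimedean_adicAbv _ hb, fun x hx => ?_⟩
  have h : (IsDiscreteValuationRing.maximalIdeal R).adicAbv hb x =
    (WithZeroMulInt.toNNReal (ne_zero_of_lt hb)
      ((IsDiscreteValuationRing.maximalIdeal R).valuation _ x) : ℝ) := rfl
  rw [h, WithZeroMulInt.toNNReal_neg_apply _
    ((Valuation.ne_zero_iff _).mpr hx), WithZero.toAdd_unzero_eq_log, ord]
  push_cast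
  rw [Real.coe_toNNReal _ (Real.exp_pos _).le, ← Real.rpow_intCast, ← Real.exp_mul]
  congr 1
  ring

variable {R}

section

variable {a : AbsoluteValue (FractionRing R) ℝ} {e : ℝ} (he : 0 < e)
  (ha : ∀ x, x ≠ 0 → a x = Real.exp (-(ord R x : ℝ) / e))

include he ha

theorem absoluteValue_le_one_iff (x : FractionRing R) :
    a x ≤ 1 ↔ x ∈ (algebraMap R (FractionRing R)).range := by
  rcases eq_or_ne x 0 with rfl | hx
  · simp
  · rw [ha x hx, ← ord_nonneg_iff R hx, Real.exp_le_one_iff, div_nonpos_iff]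
    constructor
    · rintro (h | h)
      · linarith
      · exact_mod_cast (neg_nonpos.mp h.1)
    · intro h
      exact Or.inr ⟨by simpa using h, he.le⟩

theorem absoluteValue_algebraMap_le_iff (x : R) (n : ℕ) :
    a (algebraMap R _ x) ≤ Real.exp (-n / e) ↔ x ∈ maximalIdeal R ^ n := by
  rcases eq_or_ne x 0 with rfl | hx
  · simpa using (Real.exp_pos _).le
  · rw [ha _ (by simpa using hx), mem_maximalIdeal_pow_iff_le_ord R hx, Real.exp_le_exp,
      div_le_div_iff_of_pos_right he, neg_le_neg_iff]
    exact_mod_cast Iff.rfl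

/-- Completeness of the field is what makes the spectral norm on the algebraic closure
multiplicative. A Cauchy sequence, translated by its first term, lies in `R`, where adic
completeness applies. -/
theorem completeSpace_of_absoluteValue [IsAdicComplete (maximalIdeal R) R] :
    @CompleteSpace _ a.toNormedField.toMetricSpace.toUniformSpace := by
  let := a.toNormedField
  have hnorm : ∀ x : FractionRing R, ‖x‖ = a x := fun _ => rfl
  refine Metric.complete_of_convergent_controlled_sequences
    (fun n => Real.exp (-n / e)) (fun n => Real.exp_pos _) fun u hu => ?_
  have h0 : ∀ n, ∃ y : R, algebraMap R (FractionRing R) y = u n - u 0 := fun n => by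
    refine (absoluteValue_le_one_iff he ha _).mp ?_
    rw [← hnorm, ← dist_eq_norm]
    simpa using (hu 0 n 0 (Nat.zero_le _) le_rfl).le
  choose y hy using h0
  have hmod : ∀ {m n}, m ≤ n → y m ≡ y n [SMOD (maximalIdeal R ^ m • ⊤ : Submodule R R)] := by
    intro m n hmn
    rw [SModEq.sub_mem, smul_eq_mul, Ideal.mul_top, ← absoluteValue_algebraMap_le_iff he ha,
      map_sub, hy, hy, sub_sub_sub_cancel_right, ← hnorm, ← dist_eq_norm]
    exact (hu m m n le_rfl hmn).le
  obtain ⟨l, hl⟩ := IsPrecomplete.prec' y hmod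
  refine ⟨u 0 + algebraMap R _ l, ?_⟩
  rw [tendsto_iff_dist_tendsto_zero]
  have hlim : Filter.Tendsto (fun n : ℕ => Real.exp (-n / e)) Filter.atTop (nhds 0) := by
    refine Real.tendsto_exp_atBot.comp ?_
    refine Filter.Tendsto.atBot_div_const he ?_
    exact Filter.tendsto_neg_atTop_atBot.comp tendsto_natCast_atTop_atTop
  refine squeeze_zero (fun n => dist_nonneg) (fun n => ?_) hlim
  have h := hl n
  rw [SModEq.sub_mem, smul_eq_mul, Ideal.mul_top, ← absoluteValue_algebraMap_le_iff he ha,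
    map_sub, hy, ← hnorm] at h
  rwa [dist_eq_norm, ← sub_sub]

end

/-- The norm `exp (-ν̃)` on the algebraic closure of the fraction field, as a valuation. -/
theorem exists_valuation_algebraicClosure [CharZero R] [Fact p.Prime]
    [CharP (ResidueField R) p] [IsAdicComplete (maximalIdeal R) R] :
    ∃ v : Valuation (AlgebraicClosure (FractionRing R)) ℝ≥0,
      (∀ y, y ≠ 0 → normVal p R y = ((-Real.log (v y) : ℝ) : EReal)) ∧
      (∀ y, v y ≤ 1 → IsIntegral R y) ∧
      ∀ x : FractionRing R, x ≠ 0 →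
        (v (algebraMap _ _ x) : ℝ) = Real.exp (-(ord R x : ℝ) / ramIndex p R) := by
  have he : (0 : ℝ) < ramIndex p R := by exact_mod_cast ramIndex_pos p
  obtain ⟨a, hna, ha⟩ := exists_absoluteValue R (ramIndex p R : ℝ) he
  have hcomplete := completeSpace_of_absoluteValue he ha
  let := a.toNormedField
  have hnorm : ∀ x : FractionRing R, ‖x‖ = a x := fun _ => rfl
  have : IsUltrametricDist (FractionRing R) :=
    IsUltrametricDist.isUltrametricDist_of_isNonarchimedean_norm hna
  let : NontriviallyNormedField (FractionRing R) :=
    { a.toNormedField with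
      non_trivial := by
        have hp : (p : FractionRing R) ≠ 0 := by exact_mod_cast (Fact.out : p.Prime).ne_zero
        refine ⟨(p : FractionRing R)⁻¹, ?_⟩
        change 1 < a _
        rw [map_inv₀, ha _ hp, ← Real.exp_neg, Real.one_lt_exp_iff, neg_div, neg_neg]
        exact div_pos he he }
  let : NormedField (AlgebraicClosure (FractionRing R)) :=
    spectralNorm.normedField (FractionRing R) _
  have hsp : ∀ y : AlgebraicClosure (FractionRing R), ‖y‖ = spectralNorm (FractionRing R) _ y :=
    fun _ => rfl
  have : IsUltrametricDist (AlgebraicClosure (FractionRing R)) :=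
    IsUltrametricDist.isUltrametricDist_of_isNonarchimedean_norm isNonarchimedean_spectralNorm
  refine ⟨NormedField.valuation, fun y hy => ?_, fun y hy => ?_, fun x hx => ?_⟩
  · have hint : IsIntegral (FractionRing R) y := Algebra.IsIntegral.isIntegral y
    have hc : (minpoly (FractionRing R) y).coeff 0 ≠ 0 := minpoly.coeff_zero_ne_zero hint hy
    rw [normVal, if_neg hy, NormedField.valuation_apply, coe_nnnorm, hsp,
      spectralNorm.spectralNorm_eq_norm_coeff_zero_rpow, hnorm, ha _ hc,
      Real.log_rpow (Real.exp_pos _), Real.log_exp]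
    congr 1
    field_simp
  · have h1 : spectralNorm (FractionRing R) _ y ≤ 1 := by
      rw [← hsp]; exact_mod_cast hy
    have hmon := minpoly.monic (Algebra.IsIntegral.isIntegral (R := FractionRing R) y)
    rw [spectralNorm, spectralValue_le_one_iff hmon] at h1
    -- Spectral norm at most 1 means that all coefficients of the minimal polynomial have norm at
    -- most 1, that is, lie in `R`.
    have hlift : minpoly (FractionRing R) y ∈ Polynomial.lifts (algebraMap R (FractionRing R)) := by
      rw [Polynomial.lifts_iff_coeff_lifts]
      exact fun n => (absoluteValue_le_one_iff he ha _).mp (h1 n)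
    obtain ⟨q, hq, -, hqm⟩ := Polynomial.lifts_and_natDegree_eq_and_monic hlift hmon
    refine ⟨q, hqm, ?_⟩
    rw [IsScalarTower.algebraMap_eq R (FractionRing R), ← Polynomial.eval₂_map, hq]
    exact minpoly.aeval _ _
  · rw [NormedField.valuation_apply, coe_nnnorm, hsp, spectralNorm_extends, hnorm, ha x hx]

end Norm

/-! ### The structure of `R` over `W(k)` -/

section WittStructure

open Polynomial

variable {p : ℕ}

/-- Each `p`-th power gains a factor in `J`: the cofactor of `a - b` in `a ^ p - b ^ p` is congruent
to `p * a ^ (p - 1)` modulo `J`. -/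
theorem pow_sub_pow_mem_pow {S : Type*} [CommRing S] {J : Ideal S} (hp : (p : S) ∈ J) {a b : S}
    (hab : a - b ∈ J) (n : ℕ) : a ^ p ^ n - b ^ p ^ n ∈ J ^ (n + 1) := by
  induction n with
  | zero => simpa using hab
  | succ n ih =>
    rw [pow_succ p n, pow_mul, pow_mul, ← Commute.geom_sum₂_mul (Commute.all _ _), mul_comm,
      pow_succ J]
    refine Ideal.mul_mem_mul ih ?_
    have hJ : a ^ p ^ n - b ^ p ^ n ∈ J := Ideal.pow_le_self (Nat.succ_ne_zero n) ih
    rw [← Ideal.Quotient.eq_zero_iff_mem] at hp hJ ⊢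
    rw [map_sub, sub_eq_zero] at hJ
    rw [map_natCast] at hp
    rw [RingHom.map_geom_sum₂, hJ, geom_sum₂_self, hp, zero_mul]

/-- A homomorphism out of the Witt vectors of a perfect ring is determined by its reduction modulo
a nilpotent ideal that contains `p`. -/
theorem witt_hom_ext [Fact p.Prime] {k S : Type*} [CommRing k] [CharP k p] [PerfectRing k p]
    [CommRing S]
    {J : Ideal S} (hp : (p : S) ∈ J) {N : ℕ} (hJ : J ^ N = ⊥) {a b : WittVector p k →+* S}
    (h : ∀ x, a x - b x ∈ J) : a = b := by
  apply WittVector.eq_of_apply_teichmuller_eq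
  · refine ⟨N, ?_⟩
    have := Ideal.pow_mem_pow hp N
    rwa [hJ, Ideal.mem_bot] at this
  · intro x
    -- Teichmüller representatives are multiplicative and `x` is a `p ^ N`-th power, so a congruence
    -- modulo `J` at the root `y` becomes one modulo `J ^ (N + 1)` at `x`.
    obtain ⟨y, rfl⟩ := (iterateFrobeniusEquiv k p N).surjective x
    rw [iterateFrobeniusEquiv_def, map_pow, map_pow, map_pow, ← sub_eq_zero]
    have := Ideal.pow_le_pow_right (Nat.le_succ N) (pow_sub_pow_mem_pow hp (h (.teichmuller p y)) N)
    rwa [hJ, Ideal.mem_bot] at this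

/-- The polynomial `X ^ e - p * q`. -/
def eisensteinPoly {A : Type*} [CommRing A] (p e : ℕ) (q : A[X]) : A[X] :=
  X ^ e - C (p : A) * q

theorem eisensteinPoly_map {A B : Type*} [CommRing A] [CommRing B] (f : A →+* B) (e : ℕ)
    (q : A[X]) :
    (eisensteinPoly p e q).map f = eisensteinPoly p e (q.map f) := by
  simp [eisensteinPoly]

theorem degree_C_mul_lt {A : Type*} [CommRing A] {e : ℕ} {q : A[X]} (hq : q.degree < e) (c : A) :
    (C c * q).degree < e :=
  degree_mul_le _ _ |>.trans (add_le_add_left degree_C_le _) |>.trans_lt (by simpa using hq)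

theorem eisensteinPoly_monic {A : Type*} [CommRing A] {e : ℕ} {q : A[X]} (hq : q.degree < e) :
    (eisensteinPoly p e q).Monic :=
  monic_X_pow_sub (degree_C_mul_lt hq _)

section

variable {A : Type*} [CommRing A] [IsDomain A] {e : ℕ} {q : A[X]}

theorem natDegree_eisensteinPoly (hq : q.degree < e) : (eisensteinPoly p e q).natDegree = e := by
  apply natDegree_eq_of_degree_eq_some
  rw [eisensteinPoly, degree_sub_eq_left_of_degree_lt, degree_X_pow]
  rw [degree_X_pow]
  exact degree_C_mul_lt hq _

theorem eisensteinPoly_irreducible (hp : Prime (p : A)) (he : 0 < e) (hq : q.degree < e)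
    (hq0 : IsUnit (q.coeff 0)) : Irreducible (eisensteinPoly p e q) := by
  have hmon := eisensteinPoly_monic (p := p) hq
  have hdeg := natDegree_eisensteinPoly (p := p) hq
  have hprime : (Ideal.span {(p : A)}).IsPrime := (Ideal.span_singleton_prime hp.ne_zero).mpr hp
  refine IsEisensteinAt.irreducible (𝓟 := Ideal.span {(p : A)}) ⟨?_, fun {n} hn => ?_, ?_⟩ hprime
    hmon.isPrimitive (by rw [hdeg]; exact he)
  · rw [hmon.leadingCoeff, Ideal.mem_span_singleton]
    exact fun h => hp.not_isUnit (isUnit_of_dvd_one h)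
  · rw [hdeg] at hn
    rw [eisensteinPoly, coeff_sub, coeff_X_pow, if_neg hn.ne, zero_sub, coeff_C_mul,
      Ideal.mem_span_singleton, dvd_neg]
    exact dvd_mul_right _ _
  · rw [eisensteinPoly, coeff_sub, coeff_X_pow, if_neg he.ne, zero_sub, coeff_C_mul,
      Ideal.span_singleton_pow, Ideal.mem_span_singleton, dvd_neg, sq,
      mul_dvd_mul_iff_left hp.ne_zero]
    exact fun h => hp.not_isUnit (isUnit_of_dvd_unit h hq0)

end

theorem smodEq_span_singleton_pow_smul {A M : Type*} [CommRing A] [AddCommGroup M] [Module A M]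
    (a : A) (n : ℕ) (x y : M) :
    x ≡ y [SMOD (Ideal.span {a} ^ n • ⊤ : Submodule A M)] ↔ ∃ z, x - y = a ^ n • z := by
  rw [SModEq.sub_mem, Ideal.span_singleton_pow, Submodule.ideal_span_singleton_smul,
    Submodule.mem_smul_pointwise_iff_exists]
  simp [eq_comm]

/-- Used for the free module `W(k) ^ e`, so that surjectivity of a map onto `R` can be tested modulo
`p`. -/
theorem isPrecomplete_pi_span_singleton {A : Type*} [CommRing A] (a : A) {ι : Type*}
    [IsPrecomplete (Ideal.span {a}) A] : IsPrecomplete (Ideal.span {a}) (ι → A) := by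
  refine ⟨fun f hf => ?_⟩
  have h : ∀ i, ∃ l : A, ∀ n, f n i ≡ l [SMOD (Ideal.span {a} ^ n • ⊤ : Submodule A A)] := by
    intro i
    refine IsPrecomplete.prec' (fun n => f n i) fun {m n} hmn => ?_
    obtain ⟨z, hz⟩ := (smodEq_span_singleton_pow_smul _ _ _ _).mp (hf hmn)
    exact (smodEq_span_singleton_pow_smul _ _ _ _).mpr ⟨z i, congrFun hz i⟩
  choose l hl using h
  refine ⟨l, fun n => (smodEq_span_singleton_pow_smul _ _ _ _).mpr ?_⟩
  have h2 := fun i => (smodEq_span_singleton_pow_smul _ _ _ _).mp (hl i n)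
  choose z hz using h2
  exact ⟨z, funext hz⟩

theorem prime_natCast_witt {k : Type*} [Field k] [Fact p.Prime] [CharP k p] [PerfectField k] :
    Prime (p : WittVector p k) :=
  (WittVector.irreducible p).prime

section

variable [Fact p.Prime] {R : Type*} [CommRing R] [IsDomain R] [IsDiscreteValuationRing R]
  [CharP (ResidueField R) p] [PerfectField (ResidueField R)] [IsAdicComplete (maximalIdeal R) R]

/-- This is the `ϖ`-adic expansion with Teichmüller representatives as digits. -/
theorem exists_polynomial_sub_mem_pow {ϖ : R} (hϖ : Irreducible ϖ) (x : R) (n : ℕ) :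
    ∃ q : (WittVector p (ResidueField R))[X], q.degree < n ∧
      ∃ y, x = q.eval₂ (wittEmbedding p R) ϖ + ϖ ^ n * y := by
  induction n with
  | zero => exact ⟨0, by simp, x, by simp⟩
  | succ n ih =>
    obtain ⟨q, hq, y, hy⟩ := ih
    have h : y - wittEmbedding p R (.teichmuller p (residue R y)) ∈ maximalIdeal R := by
      rw [← IsLocalRing.residue_eq_zero_iff, map_sub, residue_wittEmbedding,
        WittVector.teichmuller_coeff_zero, sub_self]
    rw [hϖ.maximalIdeal_eq, Ideal.mem_span_singleton] at h
    obtain ⟨z, hz⟩ := h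
    refine ⟨q + C (.teichmuller p (residue R y)) * X ^ n, ?_, z, ?_⟩
    · refine (degree_add_le _ _).trans_lt (max_lt (hq.trans ?_) ?_)
      · exact_mod_cast Nat.lt_succ_self n
      · refine (degree_C_mul_X_pow_le n _).trans_lt ?_
        exact_mod_cast Nat.lt_succ_self n
    · rw [hy, eval₂_add, eval₂_mul, eval₂_C, eval₂_pow, eval₂_X, pow_succ]
      linear_combination ϖ ^ n * hz

theorem wittField_eq_div {x : FractionRing R} (hx : x ∈ wittField p R) :
    ∃ a b : WittVector p (ResidueField R),
      x = algebraMap R _ (wittEmbedding p R a) / algebraMap R _ (wittEmbedding p R b) := by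
  rw [wittField, Subfield.mem_closure_iff] at hx
  obtain ⟨y, hy, z, hz, rfl⟩ := hx
  have hs : (Set.range fun w => algebraMap R (FractionRing R) (wittEmbedding p R w)) =
      (((algebraMap R (FractionRing R)).comp (wittEmbedding p R)).range : Set (FractionRing R)) :=
    rfl
  rw [hs, Subring.closure_eq] at hy hz
  obtain ⟨a, rfl⟩ := hy
  obtain ⟨b, rfl⟩ := hz
  exact ⟨a, b, rfl⟩

theorem wittEmbedding_mem_wittField (x : WittVector p (ResidueField R)) :
    algebraMap R (FractionRing R) (wittEmbedding p R x) ∈ wittField p R :=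
  Subfield.subset_closure ⟨x, rfl⟩

variable (p R) in
/-- The inclusion of `W(k)` into its fraction field `K`. -/
def wittToField : WittVector p (ResidueField R) →+* wittField p R :=
  ((algebraMap R (FractionRing R)).comp (wittEmbedding p R)).codRestrict _
    wittEmbedding_mem_wittField

end

section

variable (p) [Fact p.Prime] (R : Type*) [CommRing R] [IsDomain R] [IsDiscreteValuationRing R]
  [CharZero R] [CharP (ResidueField R) p]

/-- The absolute ramification index as a natural number. -/
def ramIdx : ℕ := (ramIndex p R).toNat

theorem ramIdx_cast : (ramIdx p R : ℤ) = ramIndex p R :=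
  Int.toNat_of_nonneg (ramIndex_pos p).le

theorem ramIdx_pos : 0 < ramIdx p R := by
  have := ramIndex_pos (R := R) p
  have := ramIdx_cast p R
  omega

variable {R}

theorem mem_pow_ramIdx_iff (n : ℕ) : (p : R) ∈ maximalIdeal R ^ n ↔ n ≤ ramIdx p R := by
  rw [mem_maximalIdeal_pow_iff_le_ord R (by exact_mod_cast (Fact.out : p.Prime).ne_zero),
    map_natCast, ← ramIndex, ← ramIdx_cast p R, Nat.cast_le]

theorem exists_eq_uniformizer_pow_mul {ϖ : R} (hϖ : Irreducible ϖ) :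
    ∃ u : Rˣ, (p : R) = ϖ ^ ramIdx p R * u := by
  obtain ⟨n, hu⟩ := IsDiscreteValuationRing.associated_pow_irreducible
    (x := (p : R)) (by exact_mod_cast (Fact.out : p.Prime).ne_zero) hϖ
  have h : ∀ m, m ≤ n ↔ m ≤ ramIdx p R := fun m => by
    rw [← mem_pow_ramIdx_iff, hϖ.maximalIdeal_eq, Ideal.span_singleton_pow,
      Ideal.mem_span_singleton, hu.dvd_iff_dvd_right, pow_dvd_pow_iff hϖ.ne_zero hϖ.not_isUnit]
  have hn : n = ramIdx p R := le_antisymm ((h n).mp le_rfl) ((h _).mpr le_rfl)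
  obtain ⟨u, hu⟩ := hu.symm
  exact ⟨u, hn ▸ hu.symm⟩

variable [PerfectField (ResidueField R)] [IsAdicComplete (maximalIdeal R) R]

theorem wittEmbedding_injective : Function.Injective (wittEmbedding p R) := by
  rw [injective_iff_map_eq_zero]
  intro x hx
  by_contra h
  obtain ⟨m, b, rfl⟩ := WittVector.exists_eq_pow_p_mul' x h
  rw [map_mul, map_pow, map_natCast, mul_eq_zero] at hx
  rcases hx with hx | hx
  · exact (Fact.out : p.Prime).ne_zero (by exact_mod_cast eq_zero_of_pow_eq_zero hx)
  · exact (b.isUnit.map (wittEmbedding p R)).ne_zero hx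

variable {p}

/-- `R` is generated by `1, ϖ, …, ϖ ^ (e - 1)` as a module over `W(k)`. -/
theorem exists_eq_eval₂_wittEmbedding {ϖ : R} (hϖ : Irreducible ϖ) (x : R) :
    ∃ q : (WittVector p (ResidueField R))[X], q.degree < ramIdx p R ∧
      x = q.eval₂ (wittEmbedding p R) ϖ := by
  let A := WittVector p (ResidueField R)
  let _ : Algebra A R := (wittEmbedding p R).toAlgebra
  have halg : algebraMap A R = wittEmbedding p R := rfl
  let I : Ideal A := Ideal.span {(p : A)}
  have hpu : ¬ IsUnit (p : R) := fun h => (mem_nonunits_iff.mp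
    ((mem_maximalIdeal _).mp (natCast_mem_maximalIdeal p R))) h
  have hH : IsHausdorff I R := by
    rw [← IsHausdorff.map_algebraMap_iff (S := R), Ideal.map_span, Set.image_singleton, map_natCast]
    exact IsHausdorff.of_isDomain _ (by rwa [Ne, Ideal.span_singleton_eq_top])
  have hP : IsPrecomplete I (Fin (ramIdx p R) → A) := isPrecomplete_pi_span_singleton _
  let f : (Fin (ramIdx p R) → A) →ₗ[A] R :=
    Fintype.linearCombination A (fun i : Fin (ramIdx p R) => ϖ ^ (i : ℕ))
  have hf : ∀ q : A[X], q.degree < ramIdx p R →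
      f (fun i => q.coeff i) = q.eval₂ (wittEmbedding p R) ϖ := by
    intro q hq
    rcases eq_or_ne q 0 with rfl | hq0
    · simp [f, Fintype.linearCombination_apply]
    · rw [eval₂_eq_sum_range' _ ((natDegree_lt_iff_degree_lt hq0).mpr hq),
        Fintype.linearCombination_apply, Finset.sum_range]
      simp [Algebra.smul_def, halg]
  have hsurj : Function.Surjective f := by
    -- Surjectivity modulo `p` suffices, since the source is `p`-adically precomplete and the target
    -- Hausdorff. Modulo `p`, which is `ϖ ^ e` up to a unit, the expansion to order `e` represents
    -- `y`.
    refine surjective_of_mkQ_comp_surjective (I := I) fun y => ?_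
    obtain ⟨y, rfl⟩ := Submodule.mkQ_surjective _ y
    obtain ⟨q, hq, z, hz⟩ := exists_polynomial_sub_mem_pow (p := p) hϖ y (ramIdx p R)
    refine ⟨fun i => q.coeff i, ?_⟩
    obtain ⟨u, hu⟩ := exists_eq_uniformizer_pow_mul p hϖ
    rw [LinearMap.comp_apply, hf q hq, ← sub_eq_zero, ← map_sub, Submodule.mkQ_apply,
      Submodule.Quotient.mk_eq_zero]
    have : q.eval₂ (wittEmbedding p R) ϖ - y = (p : A) • (-(u⁻¹ : Rˣ) * z : R) := by
      rw [Algebra.smul_def, map_natCast, hu, hz]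
      linear_combination (ϖ ^ ramIdx p R * z) * u.mul_inv
    rw [this]
    exact Submodule.smul_mem_smul (Ideal.mem_span_singleton_self _) trivial
  obtain ⟨c, hc⟩ := hsurj x
  let q : A[X] := ∑ i : Fin (ramIdx p R), C (c i) * X ^ (i : ℕ)
  have hq : q.degree < ramIdx p R := by
    refine (degree_sum_le _ _).trans_lt ((Finset.sup_lt_iff ?_).mpr fun i _ => ?_)
    · exact WithBot.bot_lt_coe _
    · refine (degree_C_mul_X_pow_le _ _).trans_lt ?_
      exact_mod_cast i.2
  refine ⟨q, hq, ?_⟩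
  rw [← hc, Fintype.linearCombination_apply, eval₂_finsetSum]
  simp [Algebra.smul_def, halg]

/-- Homomorphisms out of `R` that agree on `W(k)` and on a uniformizer are equal. -/
theorem hom_ext_wittEmbedding {S : Type*} [CommRing S] {ϖ : R} (hϖ : Irreducible ϖ)
    {f g : R →+* S} (hw : ∀ x, f (wittEmbedding p R x) = g (wittEmbedding p R x))
    (hπ : f ϖ = g ϖ) : f = g := by
  ext x
  obtain ⟨q, -, rfl⟩ := exists_eq_eval₂_wittEmbedding (p := p) hϖ x
  rw [hom_eval₂, hom_eval₂, hπ]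
  congr 1
  ext x
  exact hw x

/-- A uniformizer is a root of an Eisenstein polynomial over `W(k)`. -/
theorem exists_eisensteinPoly {ϖ : R} (hϖ : Irreducible ϖ) :
    ∃ q : (WittVector p (ResidueField R))[X], q.degree < ramIdx p R ∧ IsUnit (q.coeff 0) ∧
      (eisensteinPoly p (ramIdx p R) q).eval₂ (wittEmbedding p R) ϖ = 0 := by
  obtain ⟨u, hu⟩ := exists_eq_uniformizer_pow_mul p hϖ
  -- From `ϖ ^ e = p * u⁻¹`, writing `u⁻¹` as a polynomial `q` in `ϖ` gives the equation. The
  -- constant term of `q` has the residue of `u⁻¹`, so it is a unit.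
  obtain ⟨q, hq, hqe⟩ := exists_eq_eval₂_wittEmbedding (p := p) hϖ ((u⁻¹ : Rˣ) : R)
  refine ⟨q, hq, ?_, ?_⟩
  · have h : residue R ((u⁻¹ : Rˣ) : R) = (q.coeff 0).coeff 0 := by
      rw [hqe, hom_eval₂, (IsLocalRing.residue_eq_zero_iff _).mpr
        (hϖ.maximalIdeal_eq ▸ Ideal.mem_span_singleton_self ϖ), eval₂_at_zero,
        RingHom.comp_apply, residue_wittEmbedding]
    have hne : (q.coeff 0).coeff 0 ≠ 0 := by
      rw [← h]
      exact ((u⁻¹).isUnit.map (residue R)).ne_zero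
    exact WittVector.isUnit_of_coeff_zero_ne_zero _ hne
  · rw [eisensteinPoly, eval₂_sub, eval₂_mul, eval₂_pow, eval₂_X, eval₂_C, ← hqe, map_natCast, hu,
      mul_assoc, u.mul_inv, mul_one, sub_self]

/-- A homomorphism out of `R` is given by one out of `W(k)` and a root of the Eisenstein polynomial
of a uniformizer. -/
theorem exists_hom_extending {S : Type*} [CommRing S] {ϖ : R}
    {q : (WittVector p (ResidueField R))[X]} (hϖ : Irreducible ϖ)
    (hq : q.degree < ramIdx p R) (hq0 : IsUnit (q.coeff 0))
    (hroot : (eisensteinPoly p (ramIdx p R) q).eval₂ (wittEmbedding p R) ϖ = 0)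
    (θ : WittVector p (ResidueField R) →+* S) (α : S)
    (hα : (eisensteinPoly p (ramIdx p R) q).eval₂ θ α = 0) :
    ∃ j : R →+* S, (∀ x, j (wittEmbedding p R x) = θ x) ∧ j ϖ = α := by
  let A := WittVector p (ResidueField R)
  let _ : Algebra A R := (wittEmbedding p R).toAlgebra
  have halg : algebraMap A R = wittEmbedding p R := rfl
  have : Module.IsTorsionFree A R :=
    (Module.isTorsionFree_iff_algebraMap_injective).mpr (wittEmbedding_injective p)
  have hmon := eisensteinPoly_monic (p := p) hq
  have hirr := eisensteinPoly_irreducible prime_natCast_witt (ramIdx_pos p R) hq hq0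
  have hint : IsIntegral A ϖ := ⟨_, hmon, hroot⟩
  have hdvd : minpoly A ϖ ∣ eisensteinPoly p (ramIdx p R) q :=
    minpoly.isIntegrallyClosed_dvd hint hroot
  -- As `W(k)` is integrally closed, the minimal polynomial divides every polynomial vanishing at
  -- `ϖ`. Irreducibility then makes the Eisenstein polynomial generate the kernel of evaluation.
  have hmin : minpoly A ϖ = eisensteinPoly p (ramIdx p R) q :=
    eq_of_monic_of_associated (minpoly.monic hint) hmon
      ((minpoly.irreducible hint).associated_of_dvd hirr hdvd)
  have hsurj : Function.Surjective (eval₂RingHom (wittEmbedding p R) ϖ) := fun x =>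
    let ⟨q, _, h⟩ := exists_eq_eval₂_wittEmbedding (p := p) hϖ x
    ⟨q, h.symm⟩
  have hker : RingHom.ker (eval₂RingHom (wittEmbedding p R) ϖ) ≤
      RingHom.ker (eval₂RingHom θ α) := by
    intro r hr
    obtain ⟨s, rfl⟩ := minpoly.isIntegrallyClosed_dvd hint (p := r) hr
    rw [RingHom.mem_ker, map_mul, hmin, coe_eval₂RingHom, hα, zero_mul]
  have hj : ∀ r : A[X], RingHom.liftOfSurjective _ hsurj ⟨_, hker⟩ (r.eval₂ (wittEmbedding p R) ϖ) =
      r.eval₂ θ α := fun r =>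
    RingHom.liftOfSurjective_comp_apply _ hsurj ⟨eval₂RingHom θ α, hker⟩ r
  refine ⟨RingHom.liftOfSurjective _ hsurj ⟨_, hker⟩, fun x => ?_, ?_⟩
  · simpa using hj (C x)
  · simpa using hj X

theorem isFractionRing_wittField :
    @IsFractionRing (WittVector p (ResidueField R)) _ (wittField p R) _
      (wittToField p R).toAlgebra := by
  let _ := (wittToField p R).toAlgebra
  have hinj : Function.Injective (algebraMap (WittVector p (ResidueField R)) (wittField p R)) := by
    intro x y hxy
    exact wittEmbedding_injective p (IsFractionRing.injective R (FractionRing R)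
      (congrArg Subtype.val hxy))
  have : FaithfulSMul (WittVector p (ResidueField R)) (wittField p R) :=
    (faithfulSMul_iff_algebraMap_injective _ _).mpr hinj
  refine IsFractionRing.of_field _ _ fun z => ?_
  obtain ⟨a, b, h⟩ := wittField_eq_div z.2
  exact ⟨a, b, Subtype.ext h⟩

end

end WittStructure

/-! ### Compatibility of homomorphisms with the Witt subrings -/

section Residue

variable {p : ℕ} [Fact p.Prime]
  {R₂ : Type*} [CommRing R₂] [IsDomain R₂] [IsDiscreteValuationRing R₂]
  [CharP (ResidueField R₂) p]

theorem witt_hom_ext_residueRing {k : Type*} [Field k] [CharP k p] [PerfectField k] {n : ℕ}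
    (hn : 0 < n) {a b : WittVector p k →+* ResidueRing R₂ n}
    (h : ∀ x, prResidue R₂ hn (a x) = prResidue R₂ hn (b x)) : a = b := by
  have hmem : ∀ y : R₂, prResidue R₂ hn (pr R₂ n y) = 0 ↔ y ∈ maximalIdeal R₂ := fun y =>
    IsLocalRing.residue_eq_zero_iff y
  refine witt_hom_ext (p := p) (J := (maximalIdeal R₂).map (pr R₂ n)) (N := n) ?_ ?_ fun x => ?_
  · rw [← map_natCast (pr R₂ n)]
    exact Ideal.mem_map_of_mem _ (natCast_mem_maximalIdeal p R₂)
  · rw [← Ideal.map_pow, Ideal.map_quotient_self]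
  · obtain ⟨y, hy⟩ := Ideal.Quotient.mk_surjective (a x - b x)
    rw [← hy]
    refine Ideal.mem_map_of_mem _ ((hmem y).mp ?_)
    rw [hy, map_sub, h, sub_self]

variable {R₁ : Type*} [CommRing R₁] [IsDomain R₁] [IsDiscreteValuationRing R₁]
  [IsAdicComplete (maximalIdeal R₁) R₁]
  [CharP (ResidueField R₁) p] [PerfectField (ResidueField R₁)]
  [IsAdicComplete (maximalIdeal R₂) R₂] [PerfectField (ResidueField R₂)]

/-- Both sides are homomorphisms `W(k₁) → R₂ / 𝔪₂ ^ n₂` with the same reduction to `k₂`, and the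
maximal ideal of the target is nilpotent and contains `p`. -/
theorem map_pr_wittEmbedding {n₁ n₂ : ℕ} (hn₂ : 0 < n₂)
    (φ : ResidueRing R₁ n₁ →+* ResidueRing R₂ n₂) (x : WittVector p (ResidueField R₁)) :
    φ (pr R₁ n₁ (wittEmbedding p R₁ x)) =
      pr R₂ n₂ (wittEmbedding p R₂ (WittVector.map (redHom hn₂ φ) x)) := by
  refine RingHom.congr_fun (witt_hom_ext_residueRing (p := p) hn₂
    (a := (φ.comp (pr R₁ n₁)).comp (wittEmbedding p R₁))
    (b := ((pr R₂ n₂).comp (wittEmbedding p R₂)).comp (WittVector.map (redHom hn₂ φ)))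
    fun x => ?_) x
  change prResidue R₂ hn₂ (φ (pr R₁ n₁ (wittEmbedding p R₁ x))) =
    residue R₂ (wittEmbedding p R₂ (WittVector.map (redHom hn₂ φ) x))
  rw [residue_wittEmbedding, WittVector.map_coeff, ← residue_wittEmbedding]
  rfl

/-- The same rigidity holds modulo every power of `𝔪₂`, and `R₂` is Hausdorff. -/
theorem map_wittEmbedding {g : R₁ →+* R₂} {ψ : ResidueField R₁ →+* ResidueField R₂}
    (h : ∀ x, ψ (residue R₁ x) = residue R₂ (g x)) (x : WittVector p (ResidueField R₁)) :
    g (wittEmbedding p R₁ x) = wittEmbedding p R₂ (WittVector.map ψ x) := by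
  refine RingHom.congr_fun (f := g.comp (wittEmbedding p R₁))
    (g := (wittEmbedding p R₂).comp (WittVector.map ψ)) ?_ x
  ext x
  refine (IsHausdorff.eq_iff_smodEq (I := maximalIdeal R₂)).mpr fun n => ?_
  rcases Nat.eq_zero_or_pos n with rfl | hn
  · simp [SModEq.sub_mem]
  · rw [SModEq.sub_mem, smul_eq_mul, Ideal.mul_top, ← Ideal.Quotient.eq]
    refine RingHom.congr_fun (witt_hom_ext_residueRing (p := p) hn
      (a := (pr R₂ n).comp (g.comp (wittEmbedding p R₁)))
      (b := (pr R₂ n).comp ((wittEmbedding p R₂).comp (WittVector.map ψ))) fun x => ?_) x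
    change residue R₂ (g (wittEmbedding p R₁ x)) =
      residue R₂ (wittEmbedding p R₂ (WittVector.map ψ x))
    rw [← h, residue_wittEmbedding, residue_wittEmbedding, WittVector.map_coeff]

end Residue

/-! ### Properties of the norm on the algebraic closure -/

section Valuation

open Polynomial
open scoped NNReal

theorem valuation_le_one_of_root {A F : Type*} [CommRing A] [Field F] (v : Valuation F ℝ≥0)
    {h : A →+* F} (hv : ∀ a, v (h a) ≤ 1) {f : A[X]} (hf : f.Monic) {z : F}
    (hz : f.eval₂ h z = 0) : v z ≤ 1 := by
  let h' : A →+* v.integer := h.codRestrict _ hv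
  refine (Valuation.integer.integers v).mem_of_integral ⟨f.map h', hf.map _, ?_⟩
  rw [eval₂_map]
  exact hz

theorem toAlg_eq_zero {R : Type*} [CommRing R] [IsDomain R] {x : R} : toAlg x = 0 ↔ x = 0 := by
  simp [toAlg]

/-- `toAlg` as a ring homomorphism. -/
def toAlgHom (R : Type*) [CommRing R] [IsDomain R] : R →+* AlgebraicClosure (FractionRing R) :=
  (algebraMap (FractionRing R) _).comp (algebraMap R (FractionRing R))

theorem toAlg_injective {R : Type*} [CommRing R] [IsDomain R] :
    Function.Injective (toAlg (R := R)) :=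
  (algebraMap (FractionRing R) _).injective.comp (IsFractionRing.injective R (FractionRing R))

theorem toAlgHom_apply {R : Type*} [CommRing R] [IsDomain R] (x : R) : toAlgHom R x = toAlg x := rfl

variable (p : ℕ) {R : Type*} [CommRing R] [IsDomain R] [IsDiscreteValuationRing R]

/-- `v` is the valuation `exp (-ν̃)` on the algebraic closure of the fraction field of `R`. -/
structure IsNormVal (v : Valuation (AlgebraicClosure (FractionRing R)) ℝ≥0) : Prop where
  normVal_eq : ∀ y, y ≠ 0 → normVal p R y = ((-Real.log (v y) : ℝ) : EReal)
  isIntegral : ∀ y, v y ≤ 1 → IsIntegral R y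
  algebraMap_eq : ∀ x : FractionRing R, x ≠ 0 →
    (v (algebraMap _ _ x) : ℝ) = Real.exp (-(ord R x : ℝ) / ramIndex p R)

variable {p} {v : Valuation (AlgebraicClosure (FractionRing R)) ℝ≥0}

namespace IsNormVal

theorem normVal_lt_iff (hv : IsNormVal p v) (y z : AlgebraicClosure (FractionRing R)) :
    normVal p R y < normVal p R z ↔ v z < v y := by
  have h0 : normVal p R 0 = ⊤ := by simp [normVal]
  rcases eq_or_ne y 0 with rfl | hy
  · simp [h0]
  have hvy : (0 : ℝ) < v y := by exact_mod_cast (v.pos_iff.mpr hy)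
  rcases eq_or_ne z 0 with rfl | hz
  · rw [h0, map_zero, hv.normVal_eq y hy]
    exact ⟨fun _ => v.pos_iff.mpr hy, fun _ => EReal.coe_lt_top _⟩
  have hvz : (0 : ℝ) < v z := by exact_mod_cast (v.pos_iff.mpr hz)
  rw [hv.normVal_eq y hy, hv.normVal_eq z hz, EReal.coe_lt_coe_iff, neg_lt_neg_iff,
    Real.log_lt_log_iff hvz hvy, NNReal.coe_lt_coe]

variable [CharZero R] [Fact p.Prime] [CharP (ResidueField R) p]

variable (p R) in
theorem exists_valuation [IsAdicComplete (maximalIdeal R) R] :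
    ∃ v : Valuation (AlgebraicClosure (FractionRing R)) ℝ≥0, IsNormVal p v :=
  let ⟨v, h₁, h₂, h₃⟩ := exists_valuation_algebraicClosure p (R := R)
  ⟨v, h₁, h₂, h₃⟩

theorem toAlg_le_iff (hv : IsNormVal p v) (x : R) (n : ℕ) :
    (v (toAlg x) : ℝ) ≤ Real.exp (-n / ramIndex p R) ↔ x ∈ maximalIdeal R ^ n := by
  have he : (0 : ℝ) < ramIndex p R := by exact_mod_cast ramIndex_pos p
  rcases eq_or_ne x 0 with rfl | hx
  · simpa [toAlg] using (Real.exp_pos _).le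
  · rw [toAlg, hv.algebraMap_eq _ (by simpa using hx), mem_maximalIdeal_pow_iff_le_ord R hx,
      Real.exp_le_exp, div_le_div_iff_of_pos_right he, neg_le_neg_iff]
    exact_mod_cast Iff.rfl

theorem toAlg_le_one (hv : IsNormVal p v) (x : R) : v (toAlg x) ≤ 1 := by
  rw [← NNReal.coe_le_coe]
  simpa using (hv.toAlg_le_iff x 0).mpr (by simp)

theorem natCast_eq (hv : IsNormVal p v) : (v (p : AlgebraicClosure (FractionRing R)) : ℝ) =
    Real.exp (-1) := by
  have he : (0 : ℝ) < ramIndex p R := by exact_mod_cast ramIndex_pos p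
  have h := hv.algebraMap_eq (p : FractionRing R)
    (by exact_mod_cast (Fact.out : p.Prime).ne_zero)
  rw [map_natCast, ← ramIndex, neg_div, div_self he.ne'] at h
  exact h

/-- By the norm formula `ν̃(y)` is rational. This reduces a comparison of valuations to elements of
norm 1. -/
theorem exists_pow_eq_zpow (hv : IsNormVal p v) {y : AlgebraicClosure (FractionRing R)}
    (hy : y ≠ 0) : ∃ n : ℕ, 0 < n ∧ ∃ m : ℤ, v y ^ n = v (p : AlgebraicClosure _) ^ m := by
  have hint : IsIntegral (FractionRing R) y := Algebra.IsIntegral.isIntegral y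
  have hd := minpoly.natDegree_pos hint
  have hvy : (0 : ℝ) < v y := by exact_mod_cast (v.pos_iff.mpr hy)
  have he : (0 : ℝ) < ramIndex p R := by exact_mod_cast ramIndex_pos p
  have hd' : (0 : ℝ) < (minpoly (FractionRing R) y).natDegree := by exact_mod_cast hd
  have h := hv.normVal_eq y hy
  rw [normVal, if_neg hy, EReal.coe_eq_coe_iff, div_eq_iff (mul_pos hd' he).ne'] at h
  refine ⟨(minpoly (FractionRing R) y).natDegree * ramIdx p R, mul_pos hd (ramIdx_pos p R),
    ord R ((minpoly (FractionRing R) y).coeff 0), ?_⟩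
  rw [← NNReal.coe_inj, NNReal.coe_pow, NNReal.coe_zpow, hv.natCast_eq, ← Real.rpow_intCast,
    ← Real.exp_mul, ← Real.rpow_natCast, Real.rpow_def_of_pos hvy, h]
  congr 1
  have : (ramIdx p R : ℝ) = ramIndex p R := by exact_mod_cast ramIdx_cast p R
  push_cast
  rw [this]
  ring

/-- The valuation of the algebraic closure is the only one that is integral on `R`. -/
theorem comp_eq (hv : IsNormVal p v) {R' : Type*} [CommRing R'] [IsDomain R']
    [IsDiscreteValuationRing R'] [CharZero R'] [CharP (ResidueField R') p]
    {v' : Valuation (AlgebraicClosure (FractionRing R')) ℝ≥0} (hv' : IsNormVal p v')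
    (ι : AlgebraicClosure (FractionRing R) →+* AlgebraicClosure (FractionRing R'))
    (hι : ∀ x : R, v' (ι (toAlg x)) ≤ 1) (y : AlgebraicClosure (FractionRing R)) :
    v' (ι y) = v y := by
  have hle : ∀ z, v z ≤ 1 → v' (ι z) ≤ 1 := fun z hz => by
    obtain ⟨f, hf, hfz⟩ := hv.isIntegral z hz
    refine valuation_le_one_of_root v' (h := ι.comp (toAlgHom R)) hι hf ?_
    rw [← hom_eval₂]
    exact (congrArg ι hfz).trans (map_zero ι)
  have heq : ∀ z, v z = 1 → v' (ι z) = 1 := fun z hz => by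
    refine le_antisymm (hle z hz.le) ?_
    have h := hle z⁻¹ (by rw [map_inv₀, hz, inv_one])
    rw [map_inv₀, map_inv₀] at h
    have hz0 : z ≠ 0 := by rintro rfl; simp at hz
    exact (inv_le_one₀ (v'.pos_iff.mpr (by simpa using hz0))).mp h
  rcases eq_or_ne y 0 with rfl | hy
  · simp
  obtain ⟨n, hn, m, hm⟩ := hv.exists_pow_eq_zpow hy
  have hp : v (p : AlgebraicClosure (FractionRing R)) ≠ 0 :=
    (v.ne_zero_iff).mpr (by exact_mod_cast (Fact.out : p.Prime).ne_zero)
  have h := heq (y ^ n / (p : AlgebraicClosure (FractionRing R)) ^ m) (by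
    rw [map_div₀, map_pow, map_zpow₀, hm, div_self (zpow_ne_zero _ hp)])
  have hpp : v' (p : AlgebraicClosure (FractionRing R')) =
      v (p : AlgebraicClosure (FractionRing R)) := by
    rw [← NNReal.coe_inj, hv.natCast_eq, hv'.natCast_eq]
  rw [map_div₀, map_div₀, map_pow, map_pow, map_zpow₀, map_zpow₀, map_natCast, hpp, ← hm,
    div_eq_one_iff_eq (by rw [hm]; exact zpow_ne_zero _ hp)] at h
  exact (pow_left_inj₀ zero_le zero_le hn.ne').mp h

end IsNormVal

end Valuation

/-! ### Krasner's argument and distances between conjugates -/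

section Conjugates

open Polynomial
open scoped NNReal

/-- A nonzero element of the kernel would force the image of `ϖ`, and hence that of `p`, to vanish.
-/
theorem injective_of_charZero (p : ℕ) [Fact p.Prime] {R : Type*} [CommRing R] [IsDomain R]
    [IsDiscreteValuationRing R] [CharZero R] [CharP (ResidueField R) p] {S : Type*} [CommRing S]
    [IsDomain S] [CharZero S] (j : R →+* S) :
    Function.Injective j := by
  obtain ⟨ϖ, hϖ⟩ := IsDiscreteValuationRing.exists_irreducible R
  rw [injective_iff_map_eq_zero]
  intro x hx
  by_contra h
  obtain ⟨n, u, rfl⟩ := IsDiscreteValuationRing.eq_unit_mul_pow_irreducible h hϖ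
  rw [map_mul, map_pow] at hx
  have h0 : j ϖ = 0 :=
    eq_zero_of_pow_eq_zero ((mul_eq_zero.mp hx).resolve_left (u.isUnit.map j).ne_zero)
  obtain ⟨w, hw⟩ := exists_eq_uniformizer_pow_mul p hϖ
  have h1 : j (p : R) = 0 := by
    rw [hw, map_mul, map_pow, h0, zero_pow (ramIdx_pos p R).ne', zero_mul]
  rw [map_natCast] at h1
  exact (Fact.out : p.Prime).ne_zero (by exact_mod_cast h1)

/-- In the valuation ring, `y - z` divides `f(y) - f(z)`. -/
theorem valuation_eval₂_sub_le {A F : Type*} [CommRing A] [Field F] (v : Valuation F ℝ≥0)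
    {h : A →+* F} (hv : ∀ a, v (h a) ≤ 1) (f : A[X]) {y z : F} (hy : v y ≤ 1) (hz : v z ≤ 1) :
    v (f.eval₂ h y - f.eval₂ h z) ≤ v (y - z) := by
  let h' : A →+* v.integer := h.codRestrict _ hv
  obtain ⟨c, hc⟩ := sub_dvd_eval_sub (⟨y, hy⟩ : v.integer) ⟨z, hz⟩ (f.map h')
  have h1 : ∀ w : v.integer, ((eval w (f.map h') : v.integer) : F) = f.eval₂ h w := fun w => by
    rw [eval_map]
    exact hom_eval₂ f h' v.integer.subtype w
  have h2 := congrArg (Subtype.val) hc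
  rw [AddSubgroupClass.coe_sub, h1, h1, Subring.coe_mul, AddSubgroupClass.coe_sub] at h2
  rw [h2, map_mul]
  exact mul_le_of_le_one_right' c.2

/-- In characteristic 0 the algebraic closure is Galois, so `α` lies in `Frac R`. It is integral
over `R`, which is integrally closed. -/
theorem IsNormVal.mem_range_toAlg_of_fixed {p : ℕ} {R : Type*} [CommRing R] [IsDomain R]
    [IsDiscreteValuationRing R] [CharZero R]
    {v : Valuation (AlgebraicClosure (FractionRing R)) ℝ≥0} (hv : IsNormVal p v)
    {α : AlgebraicClosure (FractionRing R)} (hα : v α ≤ 1)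
    (h : ∀ τ : Gal(AlgebraicClosure (FractionRing R)/FractionRing R), τ α = α) :
    ∃ x : R, toAlg x = α := by
  obtain ⟨y, rfl⟩ := (InfiniteGalois.mem_range_algebraMap_iff_fixed α).mpr h
  have hy : IsIntegral R y :=
    (isIntegral_algebraMap_iff (algebraMap (FractionRing R) _).injective).mp (hv.isIntegral _ hα)
  obtain ⟨x, rfl⟩ := IsIntegrallyClosed.isIntegral_iff.mp hy
  exact ⟨x, rfl⟩

section

variable {p : ℕ} [Fact p.Prime] {R : Type*} [CommRing R] [IsDomain R]
  [IsDiscreteValuationRing R] [CharP (ResidueField R) p] [PerfectField (ResidueField R)]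
  [IsAdicComplete (maximalIdeal R) R]

/-- The conjugation by `σ` as a ring homomorphism. -/
def conjHom (σ : Embeddings p R) : R →+* AlgebraicClosure (FractionRing R) :=
  (σ : FractionRing R →+* AlgebraicClosure (FractionRing R)).comp (algebraMap R (FractionRing R))

theorem conjHom_apply (σ : Embeddings p R) (x : R) : conjHom σ x = conj p σ x := rfl

theorem conjHom_comp_wittEmbedding (σ : Embeddings p R) :
    (conjHom σ).comp (wittEmbedding p R) = (toAlgHom R).comp (wittEmbedding p R) := by
  ext x
  exact σ.commutes (wittToField p R x)

end

section

variable {p : ℕ} [Fact p.Prime] {R : Type*} [CommRing R] [IsDomain R]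
  [IsDiscreteValuationRing R] [CharZero R] [CharP (ResidueField R) p]
  {v : Valuation (AlgebraicClosure (FractionRing R)) ℝ≥0}

/-- A root of a monic polynomial, closer to an element `β` of `R` than a bound that separates the
roots, lies in `R`. -/
theorem IsNormVal.exists_root (hv : IsNormVal p v) {f : R[X]} (hf : f.Monic) {e : ℕ} (he : 0 < e)
    (hfe : f.natDegree = e) {β : R} {ρ : ℝ≥0} (hβ : v (toAlg (f.eval β)) ≤ ρ)
    (hsep : ∀ α α' : AlgebraicClosure (FractionRing R), f.eval₂ (toAlgHom R) α = 0 →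
      f.eval₂ (toAlgHom R) α' = 0 → α ≠ α' → ρ < v (α - α') ^ e) :
    ∃ γ : R, f.eval γ = 0 ∧ v (toAlg γ - toAlg β) ^ e ≤ ρ := by
  classical
  let F := f.map (toAlgHom R)
  have hF : F.Monic := hf.map _
  have hsplit : F.Splits := IsAlgClosed.splits F
  have hcard : F.roots.card = e := by
    rw [← hsplit.natDegree_eq_card_roots, hf.natDegree_map, hfe]
  have hmem : ∀ α, α ∈ F.roots ↔ f.eval₂ (toAlgHom R) α = 0 := fun α => by
    rw [mem_roots hF.ne_zero, IsRoot.def, eval_map]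
  have hne : F.roots.toFinset.Nonempty := by
    rw [Multiset.toFinset_nonempty, ← Multiset.card_pos, hcard]
    exact he
  obtain ⟨α, hα, hmin⟩ := Finset.exists_min_image F.roots.toFinset (fun a => v (toAlg β - a)) hne
  rw [Multiset.mem_toFinset] at hα
  -- The norm of `f(β)` is the product of the `e` distances from `β` to the roots, each at least the
  -- smallest one.
  have hαβ : v (toAlg β - α) ^ e ≤ ρ := by
    refine le_trans ?_ hβ
    rw [← toAlgHom_apply (eval β f), ← eval₂_hom, ← eval_map, hsplit.eval_eq_prod_roots_of_monic hF,
      map_multiset_prod, Multiset.map_map, ← hcard, ← Multiset.card_map (fun a => v (toAlg β - a))]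
    refine Multiset.pow_card_le_prod fun x hx => ?_
    obtain ⟨a, ha, rfl⟩ := Multiset.mem_map.mp hx
    exact hmin a (Multiset.mem_toFinset.mpr ha)
  -- Krasner: `τ` fixes `β` and preserves the norm, so `τ α` is as near to `β` as `α` is. The two
  -- roots are then too close to be distinct.
  have hfix : ∀ τ : Gal(AlgebraicClosure (FractionRing R)/FractionRing R), τ α = α := fun τ => by
    have hτR : ∀ x : R, τ (toAlg x) = toAlg x := fun x => τ.commutes _
    let τ' : AlgebraicClosure (FractionRing R) →+* AlgebraicClosure (FractionRing R) :=
      RingHomClass.toRingHom τ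
    have hτ : τ'.comp (toAlgHom R) = toAlgHom R := RingHom.ext hτR
    by_contra hτα
    have hroot : f.eval₂ (toAlgHom R) (τ α) = 0 := by
      have h := congrArg τ' ((hmem α).mp hα)
      rwa [hom_eval₂, hτ, map_zero] at h
    refine (hsep _ _ hroot ((hmem α).mp hα) hτα).not_ge (le_trans ?_ hαβ)
    have h1 : v (toAlg β - τ α) = v (toAlg β - α) := by
      have h := hv.comp_eq hv τ' (fun x => (congrArg v (hτR x)).trans_le (hv.toAlg_le_one x))
        (toAlg β - α)
      rw [map_sub τ'] at h
      rw [← h]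
      exact congrArg (fun z => v (z - τ α)) (hτR β).symm
    refine pow_le_pow_left' ?_ e
    calc v (τ α - α) = v ((toAlg β - α) - (toAlg β - τ α)) := by congr 1; ring
      _ ≤ max (v (toAlg β - α)) (v (toAlg β - τ α)) := v.map_sub _ _
      _ = v (toAlg β - α) := by rw [h1, max_self]
  have hα1 : v α ≤ 1 := valuation_le_one_of_root v hv.toAlg_le_one hf ((hmem α).mp hα)
  obtain ⟨γ, rfl⟩ := hv.mem_range_toAlg_of_fixed hα1 hfix
  refine ⟨γ, ?_, ?_⟩
  · have h := (hmem _).mp hα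
    rw [← toAlgHom_apply, eval₂_hom, toAlgHom_apply, toAlg_eq_zero] at h
    exact h
  · rwa [v.map_sub_swap]

end

variable {p : ℕ} [Fact p.Prime] {R : Type*} [CommRing R] [IsDomain R]
  [IsDiscreteValuationRing R] [CharZero R] [CharP (ResidueField R) p]

variable [PerfectField (ResidueField R)] [IsAdicComplete (maximalIdeal R) R]

theorem exists_monic_wittEmbedding_root (x : R) :
    ∃ f : (WittVector p (ResidueField R))[X], f.Monic ∧ f.eval₂ (wittEmbedding p R) x = 0 := by
  let _ : Algebra (WittVector p (ResidueField R)) R := (wittEmbedding p R).toAlgebra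
  obtain ⟨ϖ, hϖ⟩ := IsDiscreteValuationRing.exists_irreducible R
  obtain ⟨q, hq, -, hroot⟩ := exists_eisensteinPoly (p := p) hϖ
  have hint : IsIntegral (WittVector p (ResidueField R)) ϖ := ⟨_, eisensteinPoly_monic hq, hroot⟩
  obtain ⟨r, -, rfl⟩ := exists_eq_eval₂_wittEmbedding (p := p) hϖ x
  have h : IsIntegral (WittVector p (ResidueField R)) (aeval ϖ r) :=
    adjoin_le_integralClosure hint (aeval_mem_adjoin_singleton _ _)
  exact h

theorem isIntegral_wittField (y : FractionRing R) : IsIntegral (wittField p R) y := by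
  have h : ∀ x : R, IsIntegral (wittField p R) (algebraMap R (FractionRing R) x) := fun x => by
    obtain ⟨f, hf, hfx⟩ := exists_monic_wittEmbedding_root (p := p) x
    refine ⟨f.map (wittToField p R), hf.map _, ?_⟩
    rw [eval₂_map]
    have : (algebraMap (wittField p R) (FractionRing R)).comp (wittToField p R) =
      (algebraMap R (FractionRing R)).comp (wittEmbedding p R) := rfl
    rw [this, ← hom_eval₂, hfx, map_zero]
  obtain ⟨a, b, -, rfl⟩ := IsFractionRing.div_surjective (A := R) y
  exact (div_eq_mul_inv (algebraMap R (FractionRing R) a) _) ▸ (h a).mul (h b).inv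

/-- Gauss's lemma carries Eisenstein irreducibility from `W(k)` to `K`. -/
theorem irreducible_eisensteinPoly_map {e : ℕ} (he : 0 < e)
    {q : (WittVector p (ResidueField R))[X]} (hq : q.degree < e) (hq0 : IsUnit (q.coeff 0)) :
    Irreducible ((eisensteinPoly p e q).map (wittToField p R)) := by
  let _ := (wittToField p R).toAlgebra
  have _ : IsFractionRing (WittVector p (ResidueField R)) (wittField p R) :=
    isFractionRing_wittField
  exact ((eisensteinPoly_monic hq).irreducible_iff_irreducible_map_fraction_map
    (K := wittField p R)).mp (eisensteinPoly_irreducible prime_natCast_witt he hq hq0)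

/-- All the roots of an Eisenstein polynomial over `W(k)` are conjugate over `K`. -/
theorem exists_conj_eq_of_root {e : ℕ} (he : 0 < e) {q : (WittVector p (ResidueField R))[X]}
    (hq : q.degree < e) (hq0 : IsUnit (q.coeff 0)) {r : R}
    (hr : (eisensteinPoly p e q).eval₂ (wittEmbedding p R) r = 0)
    {α : AlgebraicClosure (FractionRing R)}
    (hα : (eisensteinPoly p e q).eval₂ ((toAlgHom R).comp (wittEmbedding p R)) α = 0) :
    ∃ σ : Embeddings p R, conj p σ r = α := by
  have hmon := eisensteinPoly_monic (p := p) hq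
  have hirr := irreducible_eisensteinPoly_map he hq hq0
  have hmin : (eisensteinPoly p e q).map (wittToField p R) =
      minpoly (wittField p R) (algebraMap R (FractionRing R) r) := by
    refine minpoly.eq_of_irreducible_of_monic hirr ?_ (hmon.map _)
    rw [aeval_def, eval₂_map]
    have : (algebraMap (wittField p R) (FractionRing R)).comp (wittToField p R) =
      (algebraMap R (FractionRing R)).comp (wittEmbedding p R) := rfl
    rw [this, ← hom_eval₂, hr, map_zero]
  refine IntermediateField.exists_algHom_of_splits_of_aeval
    (fun s => ⟨isIntegral_wittField s, IsAlgClosed.splits _⟩) ?_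
  rw [← hmin, aeval_def, eval₂_map]
  exact hα

variable {v : Valuation (AlgebraicClosure (FractionRing R)) ℝ≥0}

theorem IsNormVal.conj_le_one (hv : IsNormVal p v) (σ : Embeddings p R) (x : R) :
    v (conj p σ x) ≤ 1 := by
  obtain ⟨f, hf, hfx⟩ := exists_monic_wittEmbedding_root (p := p) x
  refine valuation_le_one_of_root v (h := (conjHom σ).comp (wittEmbedding p R))
    (fun a => ?_) hf (z := conj p σ x) ?_
  · rw [conjHom_comp_wittEmbedding]
    exact hv.toAlg_le_one _
  · rw [← conjHom_apply, ← hom_eval₂, hfx, map_zero]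

/-- A conjugation moves a uniformizer at least as far as any other element of `R`. -/
theorem IsNormVal.sub_conj_le (hv : IsNormVal p v) (σ : Embeddings p R) {ϖ : R}
    (hϖ : Irreducible ϖ) (x : R) :
    v (toAlg x - conj p σ x) ≤ v (toAlg ϖ - conj p σ ϖ) := by
  -- As `σ` fixes the coefficients of `f` in `W(k)`, the difference is `f(ϖ) - f(σ ϖ)`.
  obtain ⟨f, -, rfl⟩ := exists_eq_eval₂_wittEmbedding (p := p) hϖ x
  rw [← toAlgHom_apply, ← conjHom_apply, hom_eval₂, hom_eval₂, conjHom_comp_wittEmbedding]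
  exact valuation_eval₂_sub_le v (fun a => hv.toAlg_le_one _) f (hv.toAlg_le_one ϖ)
    (hv.conj_le_one σ ϖ)

theorem conj_ne_of_conj_ne {σ : Embeddings p R} {ϖ : R} (hϖ : Irreducible ϖ) {x : R}
    (h : conj p σ x ≠ toAlg x) : conj p σ ϖ ≠ toAlg ϖ := by
  intro hσ
  refine h (RingHom.congr_fun (f := conjHom σ) (g := toAlgHom R) ?_ x)
  exact hom_ext_wittEmbedding (p := p) hϖ
    (RingHom.congr_fun (conjHom_comp_wittEmbedding σ)) hσ

variable {R' : Type*} [CommRing R'] [IsDomain R']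
  [IsDiscreteValuationRing R'] [CharZero R'] [CharP (ResidueField R') p]
  {v' : Valuation (AlgebraicClosure (FractionRing R')) ℝ≥0}

/-- The distances between the roots of the Eisenstein polynomial of `ϖ` do not change when the
coefficients are mapped to another complete discrete valuation ring. -/
theorem IsNormVal.exists_conj_sub_eq (hv : IsNormVal p v) (hv' : IsNormVal p v')
    (θ : WittVector p (ResidueField R) →+* R') {ϖ : R} (hϖ : Irreducible ϖ)
    {q : (WittVector p (ResidueField R))[X]}
    (hq : q.degree < ramIdx p R) (hq0 : IsUnit (q.coeff 0))
    (hroot : (eisensteinPoly p (ramIdx p R) q).eval₂ (wittEmbedding p R) ϖ = 0)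
    {α α' : AlgebraicClosure (FractionRing R')}
    (hα : (eisensteinPoly p (ramIdx p R) q).eval₂ ((toAlgHom R').comp θ) α = 0)
    (hα' : (eisensteinPoly p (ramIdx p R) q).eval₂ ((toAlgHom R').comp θ) α' = 0)
    (hne : α ≠ α') :
    ∃ σ : Embeddings p R, conj p σ ϖ ≠ toAlg ϖ ∧ v (toAlg ϖ - conj p σ ϖ) = v' (α - α') := by
  have hmon := eisensteinPoly_monic (p := p) hq
  have hθ : ∀ a, v' ((toAlgHom R').comp θ a) ≤ 1 := fun a => hv'.toAlg_le_one _
  have hα1 : v' α ≤ 1 := valuation_le_one_of_root v' hθ hmon hα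
  -- The root `α` defines a map on `R` with `ϖ ↦ α`. Taking the valuation ring as codomain makes it
  -- integral, so that its extension `ι` to the algebraic closures preserves the norm.
  obtain ⟨j, hjw, hjϖ⟩ := exists_hom_extending hϖ hq hq0 hroot
    (((toAlgHom R').comp θ).codRestrict v'.integer hθ) ⟨α, hα1⟩ (by
      apply Subtype.ext
      rw [← Subring.coe_subtype, hom_eval₂]
      exact hα)
  let j' : R →+* AlgebraicClosure (FractionRing R') := v'.integer.subtype.comp j
  have hj'w : j'.comp (wittEmbedding p R) = (toAlgHom R').comp θ :=
    RingHom.ext fun x => congrArg Subtype.val (hjw x)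
  let _ : Algebra (FractionRing R) (AlgebraicClosure (FractionRing R')) :=
    (IsFractionRing.lift (injective_of_charZero p j')).toAlgebra
  let ι : AlgebraicClosure (FractionRing R) →ₐ[FractionRing R] AlgebraicClosure (FractionRing R') :=
    IsAlgClosed.lift
  have hι : ∀ x : R, ι (toAlg x) = j' x := fun x =>
    (ι.commutes _).trans (IsFractionRing.lift_algebraMap (injective_of_charZero p j') x)
  have hιw : (ι : _ →+* _).comp ((toAlgHom R).comp (wittEmbedding p R)) = (toAlgHom R').comp θ := by
    rw [← hj'w, ← RingHom.comp_assoc]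
    congr 1
    exact RingHom.ext hι
  have hιv := hv.comp_eq hv' (ι : _ →+* _) (fun x => by
    rw [RingHom.coe_coe, hι]
    exact (j x).2)
  let F := (eisensteinPoly p (ramIdx p R) q).map ((toAlgHom R).comp (wittEmbedding p R))
  -- The polynomial already splits in the source of `ι`, so `α'` comes from a root there, and that
  -- root is a conjugate of `ϖ`.
  obtain ⟨r, hr⟩ := (IsAlgClosed.splits F).mem_range_of_isRoot (hmon.map _).ne_zero
    (i := (ι : _ →+* AlgebraicClosure (FractionRing R'))) (x := α') (by
      rw [map_map, hιw, IsRoot.def, eval_map]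
      exact hα')
  have hrroot : (eisensteinPoly p (ramIdx p R) q).eval₂
      ((toAlgHom R).comp (wittEmbedding p R)) r = 0 := by
    apply (ι : _ →+* AlgebraicClosure (FractionRing R')).injective
    rw [hom_eval₂, hιw, hr, map_zero]
    exact hα'
  obtain ⟨σ, rfl⟩ := exists_conj_eq_of_root (ramIdx_pos p R) hq hq0 hroot hrroot
  have hϖα : ι (toAlg ϖ) = α := by
    rw [hι]
    exact congrArg Subtype.val hjϖ
  refine ⟨σ, fun h => hne ?_, ?_⟩
  · rw [← hϖα, ← hr, h]
    rfl
  · rw [← hιv, map_sub, hr, RingHom.coe_coe, hϖα]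

end Conjugates

/-! ### Close lifts: the separation hypothesis, existence and uniqueness -/

section Main

open Polynomial
open scoped NNReal

variable {p : ℕ}

section ResidueRing

variable {R₁ R₂ : Type*} [CommRing R₁] [IsLocalRing R₁] [CommRing R₂] [IsLocalRing R₂]
  {n₁ n₂ : ℕ} {φ : ResidueRing R₁ n₁ →+* ResidueRing R₂ n₂}

theorem pr_eq_zero_iff {R : Type*} [CommRing R] [IsLocalRing R] {n : ℕ} {x : R} :
    pr R n x = 0 ↔ x ∈ maximalIdeal R ^ n :=
  Ideal.Quotient.eq_zero_iff_mem

theorem redHom_surjective (hn₂ : 0 < n₂) (hφ : Function.Surjective φ) :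
    Function.Surjective (redHom hn₂ φ) := by
  intro y
  obtain ⟨y, rfl⟩ := IsLocalRing.residue_surjective y
  obtain ⟨x, hx⟩ := hφ (pr R₂ n₂ y)
  obtain ⟨x, rfl⟩ := Ideal.Quotient.mk_surjective x
  exact ⟨residue R₁ x, congrArg (prResidue R₂ hn₂) hx⟩

end ResidueRing

/-- A uniformizer `τ` of `R₂` comes, modulo `𝔪₂ ^ n₂`, from a multiple of `π`, so `τ` is a multiple
of `β` modulo `𝔪₂ ^ 2`. This is where `n₂ ≥ 2` is needed. -/
theorem irreducible_of_pr_eq {R₁ R₂ : Type*} [CommRing R₁] [IsDomain R₁]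
    [IsDiscreteValuationRing R₁] [CommRing R₂] [IsDomain R₂] [IsDiscreteValuationRing R₂]
    {n₁ n₂ : ℕ} {φ : ResidueRing R₁ n₁ →+* ResidueRing R₂ n₂} (hn : 2 ≤ n₂)
    (hφ : Function.Surjective φ) {π : R₁} (hπ : Irreducible π) {β : R₂} (hβ : pr R₂ n₂ β = φ (pr R₁ n₁ π)) : Irreducible β := by
  have hn₂ : 0 < n₂ := by omega
  have hres : ∀ (x : R₁) (y : R₂), pr R₂ n₂ y = φ (pr R₁ n₁ x) →
      residue R₂ y = redHom hn₂ φ (residue R₁ x) := fun x y h => congrArg (prResidue R₂ hn₂) h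
  have hπm : residue R₁ π = 0 := (IsLocalRing.residue_eq_zero_iff _).mpr
    (hπ.maximalIdeal_eq ▸ Ideal.mem_span_singleton_self π)
  have hβm : β ∈ maximalIdeal R₂ := by
    rw [← IsLocalRing.residue_eq_zero_iff, hres π β hβ, hπm, map_zero]
  obtain ⟨τ, hτ⟩ := IsDiscreteValuationRing.exists_irreducible R₂
  have hτm : τ ∈ maximalIdeal R₂ := hτ.maximalIdeal_eq ▸ Ideal.mem_span_singleton_self τ
  obtain ⟨x', hx⟩ := hφ (pr R₂ n₂ τ)
  obtain ⟨x, rfl⟩ := Ideal.Quotient.mk_surjective x'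
  have hxm : x ∈ maximalIdeal R₁ := by
    rw [← IsLocalRing.residue_eq_zero_iff]
    apply (redHom hn₂ φ).injective
    rw [← hres x τ hx.symm, (IsLocalRing.residue_eq_zero_iff _).mpr hτm, map_zero]
  rw [hπ.maximalIdeal_eq, Ideal.mem_span_singleton] at hxm
  obtain ⟨y, rfl⟩ := hxm
  obtain ⟨z, hz⟩ := Ideal.Quotient.mk_surjective (φ (pr R₁ n₁ y))
  have hmem : τ - β * z ∈ maximalIdeal R₂ ^ 2 := by
    refine Ideal.pow_le_pow_right hn (pr_eq_zero_iff.mp ?_)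
    rw [map_sub, map_mul, ← hx, hβ, hz, map_mul, map_mul, sub_self]
  rw [hτ.maximalIdeal_eq, Ideal.span_singleton_pow, Ideal.mem_span_singleton] at hmem
  rw [hτ.maximalIdeal_eq, Ideal.mem_span_singleton] at hβm
  obtain ⟨c, rfl⟩ := hβm
  obtain ⟨d, hd⟩ := hmem
  have hc : c * z + τ * d = 1 := mul_left_cancel₀ hτ.ne_zero (by linear_combination -hd)
  have hcu : IsUnit c := by
    by_contra hcn
    refine (IsLocalRing.maximalIdeal.isMaximal R₂).ne_top ((Ideal.eq_top_iff_one _).mpr ?_)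
    rw [← hc]
    exact Ideal.add_mem _ (Ideal.mul_mem_right _ _ hcn) (Ideal.mul_mem_right _ _ hτm)
  exact (irreducible_mul_isUnit hcu).mpr hτ

section Bound

variable {R : Type*} [CommRing R] [IsDomain R] [IsDiscreteValuationRing R]

variable (p R) in
/-- The norm `exp (-n / e)` of the `n`-th power of a uniformizer. -/
def normBound (n : ℕ) : ℝ≥0 := (Real.exp (-n / ramIndex p R)).toNNReal

theorem coe_normBound (n : ℕ) : (normBound p R n : ℝ) = Real.exp (-n / ramIndex p R) :=
  Real.coe_toNNReal _ (Real.exp_pos _).le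

variable {v : Valuation (AlgebraicClosure (FractionRing R)) ℝ≥0}

variable (p v) in
/-- The ideal of all `y` with `|y| ^ e ≤ exp (-n / e_R)`. -/
def closeIdeal {e : ℕ} (he : 0 < e) (hv : ∀ x : R, v (toAlg x) ≤ 1) (n : ℕ) : Ideal R where
  carrier := {y | v (toAlg y) ^ e ≤ normBound p R n}
  zero_mem' := by
    change v (toAlg (0 : R)) ^ e ≤ _
    rw [toAlg_eq_zero.mpr rfl, map_zero, zero_pow he.ne']
    exact zero_le
  add_mem' {a b} ha hb := by
    change v (toAlg (a + b)) ^ e ≤ _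
    rw [← toAlgHom_apply, map_add]
    refine (pow_le_pow_left' (v.map_add _ _) e).trans ?_
    rcases max_cases (v (toAlgHom R a)) (v (toAlgHom R b)) with h | h
    · rw [h.1]; exact ha
    · rw [h.1]; exact hb
  smul_mem' c a ha := by
    change v (toAlg (c * a)) ^ e ≤ _
    rw [← toAlgHom_apply, map_mul, map_mul]
    exact (pow_le_pow_left' (mul_le_of_le_one_left' (hv c)) e).trans ha

theorem mem_closeIdeal {e : ℕ} {he : 0 < e} {hv : ∀ x : R, v (toAlg x) ≤ 1} {n : ℕ} {x : R} :
    x ∈ closeIdeal p v he hv n ↔ v (toAlg x) ^ e ≤ normBound p R n := Iff.rfl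

theorem mem_closeIdeal_sub {e n : ℕ} {he : 0 < e} {hv : ∀ x : R, v (toAlg x) ≤ 1} {a b : R} :
    a - b ∈ closeIdeal p v he hv n ↔ v (toAlg a - toAlg b) ^ e ≤ normBound p R n := by
  rw [mem_closeIdeal, ← toAlgHom_apply, map_sub, toAlgHom_apply, toAlgHom_apply]

variable [Fact p.Prime] [CharZero R] [CharP (ResidueField R) p]

theorem IsNormVal.le_normBound_iff (hv : IsNormVal p v) {n : ℕ} {x : R} :
    v (toAlg x) ≤ normBound p R n ↔ x ∈ maximalIdeal R ^ n := by
  rw [← hv.toAlg_le_iff, ← NNReal.coe_le_coe, coe_normBound]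

theorem pow_le_closeIdeal {e : ℕ} (he : 0 < e) (hv : IsNormVal p v) (n : ℕ) :
    maximalIdeal R ^ n ≤ closeIdeal p v he hv.toAlg_le_one n := fun x hx =>
  mem_closeIdeal.mpr ((pow_le_of_le_one zero_le (hv.toAlg_le_one x) he.ne').trans
    (hv.le_normBound_iff.mpr hx))

end Bound

variable [Fact p.Prime]

variable {R₁ : Type*} [CommRing R₁] [IsDomain R₁] [IsDiscreteValuationRing R₁] [CharZero R₁]
  [IsAdicComplete (maximalIdeal R₁) R₁]
  [CharP (ResidueField R₁) p] [PerfectField (ResidueField R₁)]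
  {v₁ : Valuation (AlgebraicClosure (FractionRing R₁)) ℝ≥0}

variable (p v₁) in
/-- The conjugates of `ϖ` other than `ϖ` have distance larger than `ρ ^ (1 / e)` from `ϖ`. -/
def Separated (ρ : ℝ≥0) (ϖ : R₁) : Prop :=
  ∀ σ : Embeddings p R₁, conj p σ ϖ ≠ toAlg ϖ → ρ < v₁ (toAlg ϖ - conj p σ ϖ) ^ ramIdx p R₁

/-- Independence of the uniformizer: `σ` moves `ϖ` at least as far as it moves `π`. -/
theorem Separated.of_uniformizer (hv₁ : IsNormVal p v₁) {ρ : ℝ≥0} {π ϖ : R₁} (hπ : Irreducible π)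
    (hϖ : Irreducible ϖ) (h : Separated p v₁ ρ π) : Separated p v₁ ρ ϖ := fun σ hσ =>
  (h σ (conj_ne_of_conj_ne hπ hσ)).trans_le (pow_le_pow_left' (hv₁.sub_conj_le σ hϖ π) _)

/-- Each `ν̃(π - σ π) * e₁ * e₂` is less than `n`. Dividing by `-e₂` and exponentiating gives the
claim, which is vacuous when `M` is `-∞`. -/
theorem separated_of_M_lt (hv₁ : IsNormVal p v₁)
    {R₂ : Type*} [CommRing R₂] [IsDomain R₂] [IsDiscreteValuationRing R₂] [CharZero R₂]
    [CharP (ResidueField R₂) p] {π : R₁} {n : ℕ}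
    (hM : M p π * ((ramIndex p R₁ : ℝ) : EReal) * ((ramIndex p R₂ : ℝ) : EReal) < (n : EReal)) :
    Separated p v₁ (normBound p R₂ n) π := by
  intro σ hσ
  have he₁ : (0 : ℝ) < ramIndex p R₁ := by exact_mod_cast ramIndex_pos p
  have he₂ : (0 : ℝ) < ramIndex p R₂ := by exact_mod_cast ramIndex_pos p
  have hne : toAlg π - conj p σ π ≠ 0 := sub_ne_zero.mpr hσ.symm
  have hpos : (0 : ℝ) < v₁ (toAlg π - conj p σ π) := by exact_mod_cast v₁.pos_iff.mpr hne
  have hle : normVal p R₁ (toAlg π - conj p σ π) ≤ M p π :=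
    le_iSup (fun σ : {σ : Embeddings p R₁ // conj p σ π ≠ toAlg π} =>
      normVal p R₁ (toAlg π - conj p σ.1 π)) ⟨σ, hσ⟩
  rw [hv₁.normVal_eq _ hne] at hle
  have h := (mul_le_mul_of_nonneg_right (mul_le_mul_of_nonneg_right hle
    (EReal.coe_nonneg.mpr he₁.le)) (EReal.coe_nonneg.mpr he₂.le)).trans_lt hM
  have h' : -Real.log (v₁ (toAlg π - conj p σ π)) * ramIndex p R₁ * ramIndex p R₂ < n := by
    exact_mod_cast h
  rw [← NNReal.coe_lt_coe, coe_normBound, NNReal.coe_pow, ← Real.rpow_natCast,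
    Real.rpow_def_of_pos hpos, Real.exp_lt_exp, div_lt_iff₀ he₂]
  have hc : (ramIdx p R₁ : ℝ) = ramIndex p R₁ := by exact_mod_cast ramIdx_cast p R₁
  rw [hc]
  linarith

/-- If `R` is ramified, a uniformizer has another conjugate, at distance at most `|p| ^ (1 / e)`. -/
theorem exists_conj_sub_pow_le (hv₁ : IsNormVal p v₁) {π : R₁} (hπ : Irreducible π)
    (he : 2 ≤ ramIdx p R₁) :
    ∃ σ : Embeddings p R₁, conj p σ π ≠ toAlg π ∧
      v₁ (toAlg π - conj p σ π) ^ ramIdx p R₁ ≤ v₁ (p : AlgebraicClosure (FractionRing R₁)) := by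
  classical
  obtain ⟨q, hq, hq0, hroot⟩ := exists_eisensteinPoly (p := p) hπ
  have hirr := irreducible_eisensteinPoly_map (ramIdx_pos p R₁) hq hq0
  have hmon := eisensteinPoly_monic (p := p) hq
  let h := (toAlgHom R₁).comp (wittEmbedding p R₁)
  let F := (eisensteinPoly p (ramIdx p R₁) q).map h
  have hF : F = ((eisensteinPoly p (ramIdx p R₁) q).map (wittToField p R₁)).map
      (algebraMap (wittField p R₁) (AlgebraicClosure (FractionRing R₁))) := by
    rw [map_map]
    rfl
  -- Irreducible over a field of characteristic 0, hence separable: there are `e ≥ 2` distinct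
  -- roots.
  have hnodup : F.roots.Nodup := nodup_roots (hF ▸ hirr.separable.map)
  have hcard : F.roots.toFinset.card = ramIdx p R₁ := by
    rw [Multiset.toFinset_card_of_nodup hnodup, ← (IsAlgClosed.splits F).natDegree_eq_card_roots,
      hmon.natDegree_map, natDegree_eisensteinPoly hq]
  obtain ⟨α, hα, hne⟩ := Finset.exists_mem_ne (s := F.roots.toFinset) (by omega) (toAlg π)
  rw [Multiset.mem_toFinset, mem_roots (hmon.map _).ne_zero, IsRoot.def, eval_map] at hα
  obtain ⟨σ, rfl⟩ := exists_conj_eq_of_root (ramIdx_pos p R₁) hq hq0 hroot hα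
  obtain ⟨u, hu⟩ := exists_eq_uniformizer_pow_mul p hπ
  have key : ∀ j : R₁ →+* AlgebraicClosure (FractionRing R₁), (∀ x, v₁ (j x) ≤ 1) →
      v₁ (j π) ^ ramIdx p R₁ ≤ v₁ (p : AlgebraicClosure (FractionRing R₁)) := fun j hj => by
    have hπu : π ^ ramIdx p R₁ = p * (u⁻¹ : R₁ˣ) := by rw [hu, mul_assoc, u.mul_inv, mul_one]
    rw [← map_pow, ← map_pow, hπu, map_mul, map_mul, map_natCast]
    exact mul_le_of_le_one_right' (hj _)
  refine ⟨σ, hne, (pow_le_pow_left' (v₁.map_sub _ _) _).trans ?_⟩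
  rcases max_cases (v₁ (toAlg π)) (v₁ (conj p σ π)) with h | h
  · rw [h.1]
    exact key (toAlgHom R₁) hv₁.toAlg_le_one
  · rw [h.1]
    exact key (conjHom σ) (hv₁.conj_le_one σ)

variable {R₂ : Type*} [CommRing R₂] [IsDomain R₂] [IsDiscreteValuationRing R₂] [CharZero R₂]
  [IsAdicComplete (maximalIdeal R₂) R₂]
  [CharP (ResidueField R₂) p] [PerfectField (ResidueField R₂)]
  {v₂ : Valuation (AlgebraicClosure (FractionRing R₂)) ℝ≥0}

omit [IsAdicComplete (maximalIdeal R₂) R₂] [PerfectField (ResidueField R₂)] in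
-- A conjugate with `|π - σ π| ^ e₁ ≤ |p|` gives `exp (-n / e₂) < exp (-1)`.
theorem Separated.ramIdx_lt (hv₁ : IsNormVal p v₁) {π : R₁} (hπ : Irreducible π) {n : ℕ}
    (h : Separated p v₁ (normBound p R₂ n) π) (he : 2 ≤ ramIdx p R₁) : ramIdx p R₂ < n := by
  obtain ⟨σ, hσ, hle⟩ := exists_conj_sub_pow_le hv₁ hπ he
  have h1 := (h σ hσ).trans_le hle
  have he₂ : (0 : ℝ) < ramIndex p R₂ := by exact_mod_cast ramIndex_pos p
  rw [← NNReal.coe_lt_coe, coe_normBound, hv₁.natCast_eq, Real.exp_lt_exp, div_lt_iff₀ he₂,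
    neg_one_mul, neg_lt_neg_iff] at h1
  have h2 : ramIndex p R₂ < n := by exact_mod_cast h1
  have := ramIdx_cast p R₂
  omega

section Lift

variable {n₁ n₂ : ℕ} {hn₂ : 0 < n₂} {φ : ResidueRing R₁ n₁ →+* ResidueRing R₂ n₂}

variable (hn₂ φ) in
/-- `g` induces the same map as `φ` on the residue fields and agrees with `φ` up to the error
`exp (-n₂ / e₂)` in the `e₁`-th power of the norm. -/
structure IsCloseLift (hv₂ : IsNormVal p v₂) (g : R₁ →+* R₂) : Prop where
  residue_eq : ∀ x : R₁, redHom hn₂ φ (residue R₁ x) = residue R₂ (g x)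
  sub_mem : ∀ (x : R₁) (β : R₂), pr R₂ n₂ β = φ (pr R₁ n₁ x) →
    g x - β ∈ closeIdeal p v₂ (ramIdx_pos p R₁) hv₂.toAlg_le_one n₂

/-- The admissible errors form an ideal `J ⊇ 𝔪₂ ^ n₂`, so closeness is the equality of two
homomorphisms `R₁ → R₂ / J`, which need only be checked on `W(k₁)` and at one uniformizer. -/
theorem IsCloseLift.of_uniformizer (hv₂ : IsNormVal p v₂) {g : R₁ →+* R₂}
    (hg : ∀ x : R₁, redHom hn₂ φ (residue R₁ x) = residue R₂ (g x)) {ϖ : R₁} (hϖ : Irreducible ϖ)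
    {β : R₂} (hβ : pr R₂ n₂ β = φ (pr R₁ n₁ ϖ))
    (h : g ϖ - β ∈ closeIdeal p v₂ (ramIdx_pos p R₁) hv₂.toAlg_le_one n₂) :
    IsCloseLift hn₂ φ hv₂ g := by
  refine ⟨hg, fun x β' hβ' => ?_⟩
  let J := closeIdeal p v₂ (ramIdx_pos p R₁) hv₂.toAlg_le_one n₂
  have hJ : maximalIdeal R₂ ^ n₂ ≤ J := pow_le_closeIdeal (ramIdx_pos p R₁) hv₂ n₂
  have hfac : ∀ y, Ideal.Quotient.factor hJ (pr R₂ n₂ y) = Ideal.Quotient.mk J y := fun _ => rfl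
  have heq : (Ideal.Quotient.mk J).comp g =
      (Ideal.Quotient.factor hJ).comp (φ.comp (pr R₁ n₁)) := by
    refine hom_ext_wittEmbedding (p := p) hϖ (fun x => ?_) ?_
    · rw [RingHom.comp_apply, RingHom.comp_apply, RingHom.comp_apply, map_pr_wittEmbedding hn₂,
        map_wittEmbedding hg, hfac]
    · rw [RingHom.comp_apply, RingHom.comp_apply, RingHom.comp_apply, ← hβ, hfac]
      exact Ideal.Quotient.eq.mpr h
  have hx := RingHom.congr_fun heq x
  rw [RingHom.comp_apply, RingHom.comp_apply, RingHom.comp_apply, ← hβ', hfac] at hx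
  exact Ideal.Quotient.eq.mp hx

variable (p) in
/-- The homomorphism `W(k₁) → R₂` induced by a homomorphism `k₁ → k₂`. -/
def wittHom (ψ : ResidueField R₁ →+* ResidueField R₂) : WittVector p (ResidueField R₁) →+* R₂ :=
  (wittEmbedding p R₂).comp (WittVector.map ψ)

variable {ϖ : R₁} {q : (WittVector p (ResidueField R₁))[X]}

omit [IsAdicComplete (maximalIdeal R₂) R₂] [PerfectField (ResidueField R₂)] in
theorem Separated.lt_sub_pow (hv₁ : IsNormVal p v₁) (hv₂ : IsNormVal p v₂) {ρ : ℝ≥0}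
    (hsep : Separated p v₁ ρ ϖ) (hϖ : Irreducible ϖ)
    (hq : q.degree < ramIdx p R₁) (hq0 : IsUnit (q.coeff 0))
    (hroot : (eisensteinPoly p (ramIdx p R₁) q).eval₂ (wittEmbedding p R₁) ϖ = 0)
    (θ : WittVector p (ResidueField R₁) →+* R₂)
    {α α' : AlgebraicClosure (FractionRing R₂)}
    (hα : ((eisensteinPoly p (ramIdx p R₁) q).map θ).eval₂ (toAlgHom R₂) α = 0)
    (hα' : ((eisensteinPoly p (ramIdx p R₁) q).map θ).eval₂ (toAlgHom R₂) α' = 0)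
    (hne : α ≠ α') : ρ < v₂ (α - α') ^ ramIdx p R₁ := by
  rw [eval₂_map] at hα hα'
  obtain ⟨σ, hσ, h⟩ := hv₁.exists_conj_sub_eq hv₂ θ hϖ hq hq0 hroot hα hα' hne
  exact h ▸ hsep σ hσ

omit [CharZero R₁] [CharZero R₂] in
theorem eval_map_eq_zero_of_residue_eq {g : R₁ →+* R₂}
    {ψ : ResidueField R₁ →+* ResidueField R₂} (hg : ∀ x, ψ (residue R₁ x) = residue R₂ (g x))
    {f : (WittVector p (ResidueField R₁))[X]} (hroot : f.eval₂ (wittEmbedding p R₁) ϖ = 0) :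
    (f.map (wittHom p ψ)).eval (g ϖ) = 0 := by
  have h : g.comp (wittEmbedding p R₁) = wittHom p ψ := RingHom.ext (map_wittEmbedding hg)
  rw [eval_map, ← h, ← hom_eval₂, hroot, map_zero]

omit [CharZero R₁] [CharZero R₂] in
theorem eval_map_mem_of_pr_eq {β : R₂} (hβ : pr R₂ n₂ β = φ (pr R₁ n₁ ϖ))
    {f : (WittVector p (ResidueField R₁))[X]} (hroot : f.eval₂ (wittEmbedding p R₁) ϖ = 0) :
    (f.map (wittHom p (redHom hn₂ φ))).eval β ∈ maximalIdeal R₂ ^ n₂ := by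
  have h : (pr R₂ n₂).comp (wittHom p (redHom hn₂ φ)) =
      (φ.comp (pr R₁ n₁)).comp (wittEmbedding p R₁) :=
    RingHom.ext fun x => (map_pr_wittEmbedding hn₂ φ x).symm
  rw [← Ideal.Quotient.eq_zero_iff_mem, eval_map, hom_eval₂, h, hβ, ← RingHom.comp_apply,
    ← hom_eval₂, hroot, map_zero]

theorem exists_root_close (hv₁ : IsNormVal p v₁) (hv₂ : IsNormVal p v₂)
    (hsep : Separated p v₁ (normBound p R₂ n₂) ϖ) (hϖ : Irreducible ϖ)
    (hq : q.degree < ramIdx p R₁) (hq0 : IsUnit (q.coeff 0))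
    (hroot : (eisensteinPoly p (ramIdx p R₁) q).eval₂ (wittEmbedding p R₁) ϖ = 0)
    {β : R₂} (hβ : pr R₂ n₂ β = φ (pr R₁ n₁ ϖ)) :
    ∃ γ : R₂, ((eisensteinPoly p (ramIdx p R₁) q).map (wittHom p (redHom hn₂ φ))).eval γ = 0 ∧
      v₂ (toAlg γ - toAlg β) ^ ramIdx p R₁ ≤ normBound p R₂ n₂ := by
  have hmon := eisensteinPoly_monic (p := p) hq
  refine hv₂.exists_root (hmon.map _) (ramIdx_pos p R₁) ?_
    (hv₂.le_normBound_iff.mpr (eval_map_mem_of_pr_eq hβ hroot)) fun α α' hα hα' hne =>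
      hsep.lt_sub_pow hv₁ hv₂ hϖ hq hq0 hroot _ hα hα' hne
  rw [hmon.natDegree_map, natDegree_eisensteinPoly hq]

/-- Both conditions single out `g(ϖ)` as the root of the transported Eisenstein polynomial nearest
to `β`. -/
theorem isLiftingAt_iff_isCloseLift (hv₁ : IsNormVal p v₁) (hv₂ : IsNormVal p v₂)
    (hsep : Separated p v₁ (normBound p R₂ n₂) ϖ) (hϖ : Irreducible ϖ) (g : R₁ →+* R₂) :
    IsLiftingAt p ϖ hn₂ φ g ↔ IsCloseLift hn₂ φ hv₂ g := by
  obtain ⟨q, hq, hq0, hroot⟩ := exists_eisensteinPoly (p := p) hϖ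
  constructor
  · rintro ⟨⟨β, hβ, hclose⟩, hres⟩
    refine IsCloseLift.of_uniformizer hv₂ hres hϖ hβ (mem_closeIdeal_sub.mpr ?_)
    obtain ⟨γ, hγ, hγβ⟩ := exists_root_close hv₁ hv₂ hsep hϖ hq hq0 hroot hβ
    rcases eq_or_ne (g ϖ) γ with rfl | hne
    · exact hγβ
    have hgroot := eval_map_eq_zero_of_residue_eq hres hroot
    -- The transported polynomial is Eisenstein over `W(k₂)`, so `γ` is a `K₂`-conjugate of `g(ϖ)`.
    -- The lifting condition then makes `g(ϖ)` even nearer to `β` than `γ`.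
    have hmap : (eisensteinPoly p (ramIdx p R₁) q).map (wittHom p (redHom hn₂ φ)) =
        (eisensteinPoly p (ramIdx p R₁) (q.map (WittVector.map (redHom hn₂ φ)))).map
          (wittEmbedding p R₂) := by
      rw [wittHom, ← map_map, eisensteinPoly_map (WittVector.map (redHom hn₂ φ))]
    rw [hmap, eval_map] at hγ hgroot
    obtain ⟨σ, hσ⟩ := exists_conj_eq_of_root (ramIdx_pos p R₁) (degree_map_le.trans_lt hq)
      (by rw [coeff_map]; exact hq0.map _) hgroot (α := toAlg γ) (by
        rw [← toAlgHom_apply, ← hom_eval₂, hγ, map_zero])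
    have hne' : conj p σ (g ϖ) ≠ toAlg (g ϖ) := by
      rw [hσ]
      intro h
      exact hne (toAlg_injective h).symm
    have h := (hv₂.normVal_lt_iff _ _).mp (hclose σ hne')
    rw [hσ] at h
    exact (pow_le_pow_left' h.le _).trans hγβ
  · rintro ⟨hres, hclose⟩
    obtain ⟨β, hβ⟩ := Ideal.Quotient.mk_surjective (φ (pr R₁ n₁ ϖ))
    refine ⟨⟨β, hβ, fun σ hσ => (hv₂.normVal_lt_iff _ _).mpr ?_⟩, hres⟩
    have hgroot := eval_map_eq_zero_of_residue_eq hres hroot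
    have hβg := mem_closeIdeal_sub.mp (hclose ϖ β hβ)
    have hlt : normBound p R₂ n₂ < v₂ (conj p σ (g ϖ) - toAlg (g ϖ)) ^ ramIdx p R₁ := by
      refine hsep.lt_sub_pow hv₁ hv₂ hϖ hq hq0 hroot (wittHom p (redHom hn₂ φ)) ?_ ?_ hσ
      · rw [eval₂_map, wittHom, ← RingHom.comp_assoc, ← conjHom_comp_wittEmbedding σ,
          RingHom.comp_assoc, ← conjHom_apply, ← hom_eval₂, ← eval_map]
        exact (congrArg _ hgroot).trans (map_zero _)
      · rw [← toAlgHom_apply, eval₂_hom, hgroot, map_zero]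
    -- A conjugate as near to `β` as `g(ϖ)` would, by the ultrametric inequality, be too near to
    -- `g(ϖ)`.
    by_contra! hle
    refine (hβg.trans_lt hlt).not_ge (pow_le_pow_left' ?_ _)
    calc v₂ (conj p σ (g ϖ) - toAlg (g ϖ))
        = v₂ ((conj p σ (g ϖ) - toAlg β) - (toAlg (g ϖ) - toAlg β)) := by congr 1; ring
      _ ≤ max (v₂ (conj p σ (g ϖ) - toAlg β)) (v₂ (toAlg (g ϖ) - toAlg β)) := v₂.map_sub _ _
      _ = v₂ (toAlg (g ϖ) - toAlg β) := max_eq_right hle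

theorem existsUnique_isCloseLift (hv₁ : IsNormVal p v₁) (hv₂ : IsNormVal p v₂)
    (hsep : Separated p v₁ (normBound p R₂ n₂) ϖ) (hϖ : Irreducible ϖ)
    (hn₂ : 0 < n₂) (φ : ResidueRing R₁ n₁ →+* ResidueRing R₂ n₂) :
    ∃! g : R₁ →+* R₂, IsCloseLift hn₂ φ hv₂ g := by
  obtain ⟨q, hq, hq0, hroot⟩ := exists_eisensteinPoly (p := p) hϖ
  obtain ⟨β, hβ⟩ := Ideal.Quotient.mk_surjective (φ (pr R₁ n₁ ϖ))
  obtain ⟨γ, hγ, hγβ⟩ := exists_root_close (hn₂ := hn₂) hv₁ hv₂ hsep hϖ hq hq0 hroot hβ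
  obtain ⟨g, hgw, hgϖ⟩ := exists_hom_extending hϖ hq hq0 hroot (wittHom p (redHom hn₂ φ)) γ
    (by rwa [eval_map] at hγ)
  have hres : ∀ x : R₁, redHom hn₂ φ (residue R₁ x) = residue R₂ (g x) := by
    refine RingHom.congr_fun (f := (redHom hn₂ φ).comp (residue R₁)) (g := (residue R₂).comp g)
      (hom_ext_wittEmbedding (p := p) hϖ (fun x => ?_) ?_)
    · rw [RingHom.comp_apply, RingHom.comp_apply, hgw, wittHom, RingHom.comp_apply,
        residue_wittEmbedding, residue_wittEmbedding, WittVector.map_coeff]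
    -- Since `p` vanishes in `k₂` and `p = ϖ ^ e₁ * u`, the residue of `g(ϖ)` is nilpotent.
    · obtain ⟨u, hu⟩ := exists_eq_uniformizer_pow_mul p hϖ
      have h0 : residue R₁ ϖ = 0 := (IsLocalRing.residue_eq_zero_iff _).mpr
        (hϖ.maximalIdeal_eq ▸ Ideal.mem_span_singleton_self ϖ)
      have h := congrArg ((residue R₂).comp g) hu
      rw [map_natCast, CharP.cast_eq_zero, map_mul, map_pow] at h
      rw [RingHom.comp_apply, h0, map_zero, eq_zero_of_pow_eq_zero
        ((mul_eq_zero.mp h.symm).resolve_right (u.isUnit.map _).ne_zero)]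
  have hg : IsCloseLift hn₂ φ hv₂ g :=
    .of_uniformizer hv₂ hres hϖ hβ (mem_closeIdeal_sub.mpr (hgϖ ▸ hγβ))
  refine ⟨g, hg, fun g' hg' => ?_⟩
  refine hom_ext_wittEmbedding (p := p) hϖ
    (fun x => by rw [map_wittEmbedding hg'.residue_eq, map_wittEmbedding hres]) ?_
  -- Two close lifts send `ϖ` to roots whose difference obeys the bound that distinct roots exceed.
  have hsub := Ideal.sub_mem _ (hg'.sub_mem ϖ β hβ) (hg.sub_mem ϖ β hβ)
  rw [sub_sub_sub_cancel_right, mem_closeIdeal_sub] at hsub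
  by_contra hne
  have hroots : ∀ {g : R₁ →+* R₂}, IsCloseLift hn₂ φ hv₂ g →
      ((eisensteinPoly p (ramIdx p R₁) q).map (wittHom p (redHom hn₂ φ))).eval₂
        (toAlgHom R₂) (toAlg (g ϖ)) = 0 := fun {g} hg => by
    rw [← toAlgHom_apply, eval₂_hom, eval_map_eq_zero_of_residue_eq hg.residue_eq hroot, map_zero]
  exact (hsep.lt_sub_pow hv₁ hv₂ hϖ hq hq0 hroot _ (hroots hg') (hroots hg)
    (fun h => hne (toAlg_injective h))).not_ge hsub

/-! ### Lifts of isomorphisms -/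

omit [IsAdicComplete (maximalIdeal R₁) R₁] [PerfectField (ResidueField R₁)]
  [IsAdicComplete (maximalIdeal R₂) R₂] [PerfectField (ResidueField R₂)] in
theorem ramIdx_eq_of_surjective (hn : 2 ≤ n₂) (hφ : Function.Surjective φ)
    (h : 2 ≤ ramIdx p R₁ → ramIdx p R₂ < n₂) : ramIdx p R₁ = ramIdx p R₂ := by
  obtain ⟨π, hπ⟩ := IsDiscreteValuationRing.exists_irreducible R₁
  obtain ⟨β, hβ⟩ := Ideal.Quotient.mk_surjective (φ (pr R₁ n₁ π))
  have hβi := irreducible_of_pr_eq hn hφ hπ hβ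
  obtain ⟨u, hu⟩ := exists_eq_uniformizer_pow_mul p hπ
  obtain ⟨w, hw⟩ := Ideal.Quotient.mk_surjective (φ (pr R₁ n₁ u))
  have hn₂ : 0 < n₂ := by omega
  have hwu : IsUnit w := by
    rw [← IsLocalRing.residue_ne_zero_iff_isUnit]
    have : IsUnit (prResidue R₂ hn₂ (φ (pr R₁ n₁ u))) :=
      u.isUnit.map ((prResidue R₂ hn₂).comp (φ.comp (pr R₁ n₁)))
    rw [← hw] at this
    exact this.ne_zero
  have hmem : (p : R₂) - β ^ ramIdx p R₁ * w ∈ maximalIdeal R₂ ^ n₂ := by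
    rw [← pr_eq_zero_iff, map_sub, map_mul, map_pow, hβ, hw, ← map_pow, ← map_mul, ← map_pow,
      ← map_mul, ← hu]
    simp
  -- Modulo `𝔪₂ ^ n₂`, `p` is `β ^ e₁` times a unit with `β` a uniformizer, so `e₁` and `e₂` agree
  -- when truncated at `n₂`. If `e₁ = 1`, testing `k = 2` decides; otherwise `e₂ < n₂` allows the
  -- test at `e₂ + 1`.
  have key : ∀ k ≤ n₂, (k ≤ ramIdx p R₂ ↔ k ≤ ramIdx p R₁) := fun k hk => by
    rw [← mem_pow_ramIdx_iff, ← Ideal.add_mem_iff_right _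
      (neg_mem (Ideal.pow_le_pow_right hk hmem)), neg_sub, sub_add_cancel,
      hβi.maximalIdeal_eq, Ideal.span_singleton_pow, Ideal.mem_span_singleton,
      hwu.dvd_mul_right, pow_dvd_pow_iff hβi.ne_zero hβi.not_isUnit]
  have h₁ := ramIdx_pos p R₁
  have h₂ := ramIdx_pos p R₂
  rcases Nat.lt_or_ge (ramIdx p R₁) 2 with he | he
  · have := key 2 hn
    omega
  · have hlt := h he
    have := key (ramIdx p R₂) hlt.le
    have := key (ramIdx p R₂ + 1) hlt
    omega

omit [IsAdicComplete (maximalIdeal R₁) R₁] [PerfectField (ResidueField R₁)]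
  [IsAdicComplete (maximalIdeal R₂) R₂] [PerfectField (ResidueField R₂)] in
-- If `g(π)` has valuation `n`, comparing valuations of `p = g(π) ^ e₁ * g(u)` gives `n * e₁ = e₂`.
theorem irreducible_map_of_ramIdx_eq (he : ramIdx p R₁ = ramIdx p R₂) (g : R₁ →+* R₂) {π : R₁}
    (hπ : Irreducible π) : Irreducible (g π) := by
  obtain ⟨u, hu⟩ := exists_eq_uniformizer_pow_mul p hπ
  obtain ⟨τ, hτ⟩ := IsDiscreteValuationRing.exists_irreducible R₂
  have h0 : g π ≠ 0 := fun h => hπ.ne_zero (injective_of_charZero p g (h.trans (map_zero g).symm))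
  obtain ⟨n, a, ha⟩ := IsDiscreteValuationRing.eq_unit_mul_pow_irreducible h0 hτ
  have h : (p : R₂) = (a ^ ramIdx p R₁ * Units.map (g : R₁ →* R₂) u : R₂ˣ) *
      τ ^ (n * ramIdx p R₁) := by
    rw [← map_natCast g, hu, map_mul, map_pow, ha, pow_mul]
    push_cast
    rw [Units.coe_map]
    simp only [MonoidHom.coe_coe]
    ring
  obtain ⟨b, hb⟩ := exists_eq_uniformizer_pow_mul p hτ
  have hn : n * ramIdx p R₁ = ramIdx p R₂ :=
    IsDiscreteValuationRing.unit_mul_pow_congr_pow hτ hτ _ b _ _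
      (by rw [← h, hb, mul_comm])
  have hn1 : n = 1 := by
    rw [← he] at hn
    exact Nat.eq_of_mul_eq_mul_right (ramIdx_pos p R₁) (by rw [hn, one_mul])
  rw [ha, hn1, pow_one]
  exact (irreducible_units_mul a).mpr hτ

/-- As `g(π)` is a uniformizer, it generates `R₂` over `W(k₂)`, and coefficients lift along the
surjection `W(k₁) → W(k₂)`. -/
theorem surjective_of_ramIdx_eq (he : ramIdx p R₁ = ramIdx p R₂) {g : R₁ →+* R₂}
    {ψ : ResidueField R₁ →+* ResidueField R₂} (hψ : Function.Surjective ψ)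
    (hg : ∀ x, ψ (residue R₁ x) = residue R₂ (g x)) : Function.Surjective g := by
  obtain ⟨π, hπ⟩ := IsDiscreteValuationRing.exists_irreducible R₁
  intro y
  obtain ⟨f, -, rfl⟩ := exists_eq_eval₂_wittEmbedding (p := p)
    (irreducible_map_of_ramIdx_eq he g hπ) y
  obtain ⟨f, rfl⟩ := map_surjective _ (WittVector.map_surjective (p := p) ψ hψ) f
  refine ⟨f.eval₂ (wittEmbedding p R₁) π, ?_⟩
  rw [hom_eval₂, eval₂_map]
  congr 1
  exact RingHom.ext (map_wittEmbedding hg)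

end Lift

end Main

end DVRLift

end

theorem theorem2p10 (p : ℕ) [Fact p.Prime]
    {R₁ : Type*} [CommRing R₁] [IsDomain R₁] [IsDiscreteValuationRing R₁] [CharZero R₁]
    [IsAdicComplete (IsLocalRing.maximalIdeal R₁) R₁]
    [CharP (IsLocalRing.ResidueField R₁) p] [PerfectField (IsLocalRing.ResidueField R₁)]
    {R₂ : Type*} [CommRing R₂] [IsDomain R₂] [IsDiscreteValuationRing R₂] [CharZero R₂]
    [IsAdicComplete (IsLocalRing.maximalIdeal R₂) R₂]
    [CharP (IsLocalRing.ResidueField R₂) p] [PerfectField (IsLocalRing.ResidueField R₂)]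
    (π₁ : R₁) (hπ₁ : Irreducible π₁) (n₁ n₂ : ℕ) (hn₁ : 0 < n₁) (hn₂ : 0 < n₂)
    (hM : DVRLift.M p π₁ * ((DVRLift.ramIndex p R₁ : ℝ) : EReal) *
      ((DVRLift.ramIndex p R₂ : ℝ) : EReal) < (n₂ : EReal)) :
    ∃ Λ : (DVRLift.ResidueRing R₁ n₁ →+* DVRLift.ResidueRing R₂ n₂) → (R₁ →+* R₂),
      (∀ ϖ : R₁, Irreducible ϖ →
        ∀ (φ : DVRLift.ResidueRing R₁ n₁ →+* DVRLift.ResidueRing R₂ n₂) (g : R₁ →+* R₂),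
          DVRLift.IsLiftingAt p ϖ hn₂ φ g ↔ g = Λ φ) ∧
      (2 ≤ n₂ ∨ DVRLift.ramIndex p R₁ = DVRLift.ramIndex p R₂ →
        ∀ φ : DVRLift.ResidueRing R₁ n₁ →+* DVRLift.ResidueRing R₂ n₂,
          Function.Bijective φ → Function.Bijective (Λ φ)) := by
  obtain ⟨v₁, hv₁⟩ := DVRLift.IsNormVal.exists_valuation p R₁
  obtain ⟨v₂, hv₂⟩ := DVRLift.IsNormVal.exists_valuation p R₂
  have hsep := DVRLift.separated_of_M_lt hv₁ hM
  choose Λ hΛ huniq using DVRLift.existsUnique_isCloseLift (n₁ := n₁) hv₁ hv₂ hsep hπ₁ hn₂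
  refine ⟨Λ, fun ϖ hϖ φ g => ?_, fun h φ hφ => ?_⟩
  · rw [DVRLift.isLiftingAt_iff_isCloseLift hv₁ hv₂ (hsep.of_uniformizer hv₁ hπ₁ hϖ) hϖ]
    exact ⟨huniq φ g, fun h => h ▸ hΛ φ⟩
  · refine ⟨DVRLift.injective_of_charZero p _, DVRLift.surjective_of_ramIdx_eq (p := p) ?_
      (DVRLift.redHom_surjective hn₂ hφ.surjective) (hΛ φ).residue_eq⟩
    rcases h with h | h
    · exact DVRLift.ramIdx_eq_of_surjective h hφ.surjective (hsep.ramIdx_lt hv₁ hπ₁)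
    · rw [DVRLift.ramIdx, DVRLift.ramIdx, h]
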